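/- Let $\ell\ge 2$ and $D\ge 1$ be integers. For $n\ge 0$ let $\mathcal F_n$ be the family of $\ell$-adic cubes $\prod_{i=1}^D[k_i\ell^{-n},(k_i+1)\ell^{-n})$, $0\le k_i<\ell^n$, of $[0,1)^D$. Suppose that the cubes are coded by the finite words over $\{0,\dots,\ell^D-1\}$: for every $n$ the map $\varepsilon_1\cdots\varepsilon_n\mapsto I_{\varepsilon_1\cdots\varepsilon_n}$ is a bijection from the words of length $n$ onto $\mathcal F_n$, and $I_{\varepsilon_1\cdots\varepsilon_{n+1}}\subset I_{\varepsilon_1\cdots\varepsilon_n}$. For $I=I_{\varepsilon_1\cdots\varepsilon_n}$ and $J=I_{\varepsilon_{n+1}\cdots\varepsilon_{n+p}}$ put $IJ=I_{\varepsilon_1\cdots\varepsilon_{n+p}}$. Let $m$ be a quasi-Bernoulli measure on $[0,1)^D$, i.e. a Borel probability measure on $\mathbb R^D$ with $m([0,1)^D)=1$ for which there is a constant $C\ge 1$ such that $$\frac1C\,m(I)m(J)\le m(IJ)\le C\,m(I)m(J)\qquad\text{for all } I,J\in\bigcup_{n\ge 0}\mathcal F_n .$$ Let $$\tau(q)=\limsup_{n\to\infty}\frac1{n\log\ell}\log\Big(\sum_{I\in\mathcal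 F_n,\ m(I)>0}m(I)^q\Big)\qquad(q\in\mathbb R)$$ be its $L^q$-spectrum and $d=-\tau'(1)$. Suppose that there is a real $\sigma>0$ such that $$\tau(1-q)=qd+\frac{\sigma^2}{2}q^2+o(q^2)\qquad\text{as } q\to 0 .$$ Let $\mathcal H^d$ be the $d$-dimensional Hausdorff measure on $\mathbb R^D$ and let $\widehat{\mathcal P}^d$ be the $d$-dimensional packing (outer) measure $$\widehat{\mathcal P}^d(E)=\inf\Big\{\sum_{j\ge 1}\mathcal P^d(E_j):\ E\subset\bigcup_{j\ge 1} E_j\Big\},\qquad \mathcal P^d(E)=\lim_{\delta\to 0^+}\ \sup\sum_i(2r_i)^d ,$$ where the supremum is over all families of pairwise disjoint closed balls $B(x_i,r_i)$ with $x_i\in E$ and $0<r_i\le\delta$. Then: 1. There exists a Borel set $E\subset\mathbb R^D$ such that $m(E)=1$ and $\mathcal H^d(E)=0$. In particular $m\perp\mathcal H^d$. 2. For every set $E\subset\mathbb R^D$, if $\widehat{\mathcal P}^d(E)<+\infty$ then $m(E)=0$ (where $m(E)$ is the outer measure if $E$ is not measurable). In particular $m\ll\widehat{\mathcal P}^d$,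 i.e. $\widehat{\mathcal P}^d(E)=0$ implies $m(E)=0$. -/

import Mathlib

open MeasureTheory Filter Topology Asymptotics
open scoped ENNReal

noncomputable section

namespace QB

/-- The half-open cube `∏ i, [k i / ℓ ^ n, (k i + 1) / ℓ ^ n)` of `ℝ ^ D`. -/
def ladicCube (ℓ D n : ℕ) (k : Fin D → Fin (ℓ ^ n)) : Set (EuclideanSpace ℝ (Fin D)) :=
  {x | ∀ i, ((k i : ℕ) : ℝ) / (ℓ : ℝ) ^ n ≤ x i ∧ x i < (((k i : ℕ) : ℝ) + 1) / (ℓ : ℝ) ^ n}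

/-- The family `F_n` of the `ℓ`-adic cubes of generation `n` in `[0, 1) ^ D`. -/
def ladicCubes (ℓ D n : ℕ) : Set (Set (EuclideanSpace ℝ (Fin D))) :=
  Set.range (ladicCube ℓ D n)

/-- The unit cube `[0, 1) ^ D`. -/
def unitCube (D : ℕ) : Set (EuclideanSpace ℝ (Fin D)) :=
  {x | ∀ i, 0 ≤ x i ∧ x i < 1}

/-- `I` codes the `ℓ`-adic cubes by the finite words over the alphabet `{0, …, ℓ ^ D - 1}`:
the words of length `n` correspond one-to-one to the cubes of generation `n`, and the cube of a
word contains the cubes of its one-letter extensions. -/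
structure IsCubeCoding (ℓ D : ℕ)
    (I : List (Fin (ℓ ^ D)) → Set (EuclideanSpace ℝ (Fin D))) : Prop where
  bijOn : ∀ n : ℕ, Set.BijOn I {w | w.length = n} (ladicCubes ℓ D n)
  nested : ∀ (w : List (Fin (ℓ ^ D))) (a : Fin (ℓ ^ D)), I (w ++ [a]) ⊆ I w

/-- `m` is carried by `[0, 1) ^ D` and is quasi-Bernoulli for the coding `I`; the product of the
cubes `I u` and `I v` is the cube `I (u ++ v)` of the concatenated word. -/
structure IsQuasiBernoulli {ℓ D : ℕ} (I : List (Fin (ℓ ^ D)) → Set (EuclideanSpace ℝ (Fin D)))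
    (m : Measure (EuclideanSpace ℝ (Fin D))) : Prop where
  unitCube_eq_one : m (unitCube D) = 1
  quasiBernoulli : ∃ C : ℝ, 1 ≤ C ∧ ∀ u v : List (Fin (ℓ ^ D)),
    1 / C * (m.real (I u) * m.real (I v)) ≤ m.real (I (u ++ v)) ∧
      m.real (I (u ++ v)) ≤ C * (m.real (I u) * m.real (I v))

open Classical in
/-- `τ_n(q) = (n log ℓ)⁻¹ log (∑ m(I) ^ q)`, where `I` runs over the cubes of generation `n`
that have positive measure (so that `0 ^ q = 0` for every real `q`). -/
def lqSpectrumAt (ℓ : ℕ) {D : ℕ} (m : Measure (EuclideanSpace ℝ (Fin D))) (n : ℕ) (q : ℝ) : ℝ :=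
  1 / (n * Real.log ℓ) *
    Real.log (∑ k : Fin D → Fin (ℓ ^ n),
      if 0 < m.real (ladicCube ℓ D n k) then m.real (ladicCube ℓ D n k) ^ q else 0)

/-- The `L^q`-spectrum `τ(q) = limsup τ_n(q)`. -/
def lqSpectrum (ℓ : ℕ) {D : ℕ} (m : Measure (EuclideanSpace ℝ (Fin D))) (q : ℝ) : ℝ :=
  limsup (fun n : ℕ => lqSpectrumAt ℓ m n q) atTop

/-- `sup ∑ (2 r) ^ s` over the families of pairwise disjoint closed balls with centres `x` in `E`
and radii `0 < r ≤ δ`; a ball is given by the pair `(x, r)`. -/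
def packingAt {X : Type*} [PseudoMetricSpace X] (s δ : ℝ) (E : Set X) : ℝ≥0∞ :=
  ⨆ (F : Set (X × ℝ)) (_ : ∀ p ∈ F, p.1 ∈ E ∧ 0 < p.2 ∧ p.2 ≤ δ)
    (_ : F.PairwiseDisjoint fun p => Metric.closedBall p.1 p.2),
    ∑' p : F, ENNReal.ofReal (2 * p.1.2) ^ s

/-- The packing pre-measure, that is the limit (infimum) of `packingAt s δ E` as `δ` decreases
to `0`. -/
def packingPreMeasure {X : Type*} [PseudoMetricSpace X] (s : ℝ) (E : Set X) : ℝ≥0∞ :=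
  ⨅ (δ : ℝ) (_ : 0 < δ), packingAt s δ E

theorem packingPreMeasure_empty {X : Type*} [PseudoMetricSpace X] (s : ℝ) :
    packingPreMeasure s (∅ : Set X) = 0 := by
  refine le_antisymm ?_ bot_le
  refine iInf₂_le_of_le 1 one_pos ?_
  refine iSup_le fun F => iSup_le fun hF => iSup_le fun _ => ?_
  have h : IsEmpty F := ⟨fun p => (hF p.1 p.2).1⟩
  simp

/-- The `s`-dimensional packing (outer) measure, defined on all sets:
the infimum of `∑ packingPreMeasure s (E j)` over the countable covers `(E j)` of the set. -/
def packingMeasure (X : Type*) [PseudoMetricSpace X] (s : ℝ) : OuterMeasure X :=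
  OuterMeasure.ofFunction (packingPreMeasure s) (packingPreMeasure_empty s)

end QB

end

/-! The masses `p w = m(I w)` are multiplicative up to `C`, so `log (partitionSum p n q)` is
quasi-additive in `n` and equals `n T(q)` up to `|q| log C`, uniformly in `n`, with `T = τ log ℓ`.
For the deviation `X_n = -log m(I_n(x)) - n d log ℓ` one has `E exp(q X_n) = Z_n(1 - q) exp(-q n d
log ℓ)`, where `Z_n(q) = partitionSum p n q`. At `q = t/√n` the expansion of `τ` at `1` makes these
moments Gaussian up to constants. Cauchy–Schwarz between the parameters `t` and `2t` then gives
`P(±X_n > √n) ≥ c` for large `n`, with no central limit theorem (`exists_le_sum_deviation`).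

Quasi-multiplicativity carries this bound into every cube, and a set of density bounded below in all
cubes has full measure. Hence almost surely `X_n > √n/2` infinitely often and `X_n < -√n/2`
infinitely often (`ae_frequently_deviation`).

Negative deviations give cubes with `ℓ^(-nd) ≤ exp(-√n/2) m(I)`; stopping at the first such cube
yields disjoint covers with small `d`-sums (`hausdorffMeasure_eq_zero`). Positive deviations give
light cubes. By Borel–Cantelli a ball outweighs its central cube by at most `exp(√n/4)` eventually,
so balls are light too, and a Vitali covering handles packing measure. -/

namespace QB

/-! ### Quasi-additive sequences and a second moment inequality -/

/-- A quasi-additive sequence grows linearly up to a bounded error. -/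
theorem exists_tendsto_div_of_quasiAdditive {u : ℕ → ℝ} {c : ℝ}
    (h : ∀ n k, |u (n + k) - u n - u k| ≤ c) :
    ∃ L, Tendsto (fun n : ℕ => u n / n) atTop (𝓝 L) ∧ ∀ n : ℕ, |u n - n * L| ≤ c := by
  have hc : 0 ≤ c := (abs_nonneg _).trans (h 0 0)
  -- This crude growth bound only supplies the boundedness below that Fekete's lemma requires.
  have hlin : ∀ n : ℕ, |u n - u 0| ≤ n * (|u 1| + c) := by
    intro n
    induction n with
    | zero => simp
    | succ n ih =>
      have h1 := abs_le.1 (h n 1)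
      have h2 := abs_le.1 ih
      have h3 := neg_abs_le (u 1)
      have h4 := le_abs_self (u 1)
      push_cast
      rw [abs_le]
      constructor <;> linarith [h1.1, h1.2, h2.1, h2.2]
  have hdiv : ∀ n : ℕ, |u n / n| ≤ |u 0| + (|u 1| + c) := by
    intro n
    rcases Nat.eq_zero_or_pos n with rfl | hn
    · simp; positivity
    have hn' : (1 : ℝ) ≤ n := by exact_mod_cast hn
    rw [abs_div, Nat.abs_cast, div_le_iff₀ (by linarith)]
    have h1 : |u n| ≤ |u n - u 0| + |u 0| := by
      have := abs_add_le (u n - u 0) (u 0)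
      simpa using this
    nlinarith [hlin n, abs_nonneg (u 0)]
  have hcdiv : ∀ n : ℕ, 0 ≤ c / n ∧ c / n ≤ c := by
    intro n
    rcases Nat.eq_zero_or_pos n with rfl | hn
    · simpa using hc
    exact ⟨by positivity, div_le_self hc (by exact_mod_cast hn)⟩
  -- Both `u + c` and `-u + c` are subadditive; the two Fekete limits are opposite, and each bounds
  -- `u n - n L` on one side.
  have hs : Subadditive fun n => u n + c := by
    intro n k
    have := abs_le.1 (h n k)
    simp only
    linarith [this.2]
  have hs' : Subadditive fun n => -u n + c := by
    intro n k
    have := abs_le.1 (h n k)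
    simp only
    linarith [this.1]
  have hb : BddBelow (Set.range fun n : ℕ => (u n + c) / n) := by
    refine ⟨-(|u 0| + (|u 1| + c)), ?_⟩
    rintro _ ⟨n, rfl⟩
    have := (abs_le.1 (hdiv n)).1
    simp only [add_div]
    linarith [(hcdiv n).1]
  have hb' : BddBelow (Set.range fun n : ℕ => (-u n + c) / n) := by
    refine ⟨-(|u 0| + (|u 1| + c)), ?_⟩
    rintro _ ⟨n, rfl⟩
    have := (abs_le.1 (hdiv n)).2
    simp only [add_div, neg_div]
    linarith [(hcdiv n).1]
  have hc0 : Tendsto (fun n : ℕ => c / (n : ℝ)) atTop (𝓝 0) :=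
    tendsto_const_div_atTop_nhds_zero_nat c
  have ht : Tendsto (fun n : ℕ => u n / n) atTop (𝓝 hs.lim) := by
    have := (hs.tendsto_lim hb).sub hc0
    simpa [add_div] using this
  have ht' : Tendsto (fun n : ℕ => u n / n) atTop (𝓝 (-hs'.lim)) := by
    have := ((hs'.tendsto_lim hb').sub hc0).neg
    simpa [add_div, neg_div] using this
  refine ⟨hs.lim, ht, fun n => ?_⟩
  rcases Nat.eq_zero_or_pos n with rfl | hn
  · have := h 0 0
    simpa using this
  have hn' : (0 : ℝ) < n := by exact_mod_cast hn
  have h1 := hs.lim_le_div hb hn.ne'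
  have h2 := hs'.lim_le_div hb' hn.ne'
  have h3 : hs'.lim = -hs.lim := by rw [tendsto_nhds_unique ht ht', neg_neg]
  rw [h3] at h2
  rw [le_div_iff₀ hn'] at h1 h2
  rw [abs_le]
  constructor <;> linarith

/-- A finite second moment argument: a large exponential moment forces a large tail. -/
theorem exp_sq_le_tail_mul_moment {ι : Type*} (s : Finset ι) (p Y : ι → ℝ) (hp : ∀ i ∈ s, 0 ≤ p i)
    (hp1 : ∑ i ∈ s, p i ≤ 1) {θ b : ℝ} (hθ : 0 ≤ θ)
    (hM : 2 * Real.exp (θ * b) ≤ ∑ i ∈ s, p i * Real.exp (θ * Y i)) :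
    Real.exp (θ * b) ^ 2 ≤
      (∑ i ∈ s with b < Y i, p i) * ∑ i ∈ s, p i * Real.exp (2 * θ * Y i) := by
  -- Indices with `Y ≤ b` contribute at most `exp(θ b)`, half of the assumed lower bound, so the
  -- tail carries at least `exp(θ b)`. Cauchy–Schwarz with weights `p` then separates the tail mass.
  have hsplit := Finset.sum_filter_add_sum_filter_not s (fun i => b < Y i)
    (fun i => p i * Real.exp (θ * Y i))
  have hlow : ∑ i ∈ s with ¬ b < Y i, p i * Real.exp (θ * Y i) ≤ Real.exp (θ * b) := by
    calc ∑ i ∈ s with ¬ b < Y i, p i * Real.exp (θ * Y i)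
        ≤ ∑ i ∈ s with ¬ b < Y i, p i * Real.exp (θ * b) := by
          refine Finset.sum_le_sum fun i hi => ?_
          rw [Finset.mem_filter, not_lt] at hi
          have := hp i hi.1
          have := hi.2
          gcongr
      _ ≤ ∑ i ∈ s, p i * Real.exp (θ * b) :=
          Finset.sum_le_sum_of_subset_of_nonneg (Finset.filter_subset _ _)
            fun i hi _ => mul_nonneg (hp i hi) (Real.exp_nonneg _)
      _ ≤ 1 * Real.exp (θ * b) := by
          rw [← Finset.sum_mul]
          gcongr
      _ = _ := one_mul _
  have hup : Real.exp (θ * b) ≤ ∑ i ∈ s with b < Y i, p i * Real.exp (θ * Y i) := by linarith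
  calc Real.exp (θ * b) ^ 2
      ≤ (∑ i ∈ s with b < Y i, p i * Real.exp (θ * Y i)) ^ 2 := by gcongr
    _ ≤ (∑ i ∈ s with b < Y i, p i) *
          ∑ i ∈ s with b < Y i, p i * Real.exp (2 * θ * Y i) := by
        refine Finset.sum_sq_le_sum_mul_sum_of_sq_le_mul _ ?_ ?_ ?_
        · exact fun i hi => hp i (Finset.mem_filter.1 hi).1
        · exact fun i hi => mul_nonneg (hp i (Finset.mem_filter.1 hi).1) (Real.exp_nonneg _)
        · intro i _
          rw [show 2 * θ * Y i = θ * Y i + θ * Y i by ring, Real.exp_add]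
          exact le_of_eq (by ring)
    _ ≤ _ := by
        refine mul_le_mul_of_nonneg_left ?_
          (Finset.sum_nonneg fun i hi => hp i (Finset.mem_filter.1 hi).1)
        exact Finset.sum_le_sum_of_subset_of_nonneg (Finset.filter_subset _ _)
            fun i hi _ => mul_nonneg (hp i hi) (Real.exp_nonneg _)

/-! ### Quasi-multiplicative weights on words and their partition functions -/

/-- A family of weights on the finite words, of total mass `1` in each length, that is
multiplicative up to the constant `C`. -/
structure IsQuasiMul {A : Type*} [Fintype A] (p : List A → ℝ) (C : ℝ) : Prop where
  one_le : 1 ≤ C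
  nonneg : ∀ w, 0 ≤ p w
  sum_eq_one : ∀ n : ℕ, ∑ a : Fin n → A, p (List.ofFn a) = 1
  le_append : ∀ u v, 1 / C * (p u * p v) ≤ p (u ++ v)
  append_le : ∀ u v, p (u ++ v) ≤ C * (p u * p v)

open Classical in
/-- The words of length `n` with positive weight. -/
noncomputable def posWords {A : Type*} [Fintype A] (p : List A → ℝ) (n : ℕ) :
    Finset (Fin n → A) :=
  Finset.univ.filter fun a => 0 < p (List.ofFn a)

/-- The partition function `∑ p(w) ^ q` over the words of length `n` with positive weight. -/
noncomputable def partitionSum {A : Type*} [Fintype A] (p : List A → ℝ) (n : ℕ) (q : ℝ) : ℝ :=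
  ∑ a ∈ posWords p n, p (List.ofFn a) ^ q

/-- The centred logarithmic weight `-log p(w) - |w| h`. -/
noncomputable def deviation {A : Type*} (p : List A → ℝ) (h : ℝ) (w : List A) : ℝ :=
  -Real.log (p w) - w.length * h

namespace IsQuasiMul

variable {A : Type*} [Fintype A] {p : List A → ℝ} {C : ℝ}

theorem mem_posWords {n : ℕ} {a : Fin n → A} : a ∈ posWords p n ↔ 0 < p (List.ofFn a) := by
  simp [posWords]

theorem append_pos_iff (hp : IsQuasiMul p C) (u v : List A) :
    0 < p (u ++ v) ↔ 0 < p u ∧ 0 < p v := by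
  have hC : 0 < C := zero_lt_one.trans_le hp.one_le
  constructor
  · intro h
    have h1 : 0 < C * (p u * p v) := h.trans_le (hp.append_le u v)
    have h2 : 0 < p u * p v := pos_of_mul_pos_right h1 hC.le
    exact ⟨pos_of_mul_pos_left h2 (hp.nonneg v), pos_of_mul_pos_right h2 (hp.nonneg u)⟩
  · rintro ⟨hu, hv⟩
    exact lt_of_lt_of_le (by positivity) (hp.le_append u v)

theorem abs_log_append_le (hp : IsQuasiMul p C) {u v : List A} (hu : 0 < p u) (hv : 0 < p v) :
    |Real.log (p (u ++ v)) - Real.log (p u) - Real.log (p v)| ≤ Real.log C := by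
  have hC : 0 < C := zero_lt_one.trans_le hp.one_le
  have huv := (hp.append_pos_iff u v).2 ⟨hu, hv⟩
  have h1 := Real.log_le_log (by positivity) (hp.le_append u v)
  have h2 := Real.log_le_log huv (hp.append_le u v)
  rw [Real.log_mul (by positivity) (by positivity), Real.log_mul hu.ne' hv.ne', one_div,
    Real.log_inv] at h1
  rw [Real.log_mul (by positivity) (by positivity), Real.log_mul hu.ne' hv.ne'] at h2
  rw [abs_le]
  constructor <;> linarith

theorem abs_deviation_append_le (hp : IsQuasiMul p C) (h : ℝ) {u v : List A} (hu : 0 < p u)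
    (hv : 0 < p v) :
    |deviation p h (u ++ v) - deviation p h u - deviation p h v| ≤ Real.log C := by
  have := hp.abs_log_append_le hu hv
  rw [← abs_neg] at this
  convert this using 2
  simp only [deviation, List.length_append, Nat.cast_add]
  ring

theorem sum_posWords (hp : IsQuasiMul p C) (n : ℕ) :
    ∑ a ∈ posWords p n, p (List.ofFn a) = 1 := by
  rw [← hp.sum_eq_one n]
  refine Finset.sum_subset (Finset.subset_univ _) fun a _ ha => ?_
  rw [mem_posWords, not_lt] at ha
  exact le_antisymm ha (hp.nonneg _)

theorem partitionSum_pos (hp : IsQuasiMul p C) (n : ℕ) (q : ℝ) : 0 < partitionSum p n q := by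
  refine Finset.sum_pos (fun a ha => Real.rpow_pos_of_pos (mem_posWords.1 ha) _) ?_
  by_contra hne
  have := hp.sum_posWords n
  rw [Finset.not_nonempty_iff_eq_empty.1 hne] at this
  simp at this

/-- Cutting a word after `n` letters is a bijection, and it respects the restriction to positive
weights because positivity factorises over concatenation. -/
theorem partitionSum_add (hp : IsQuasiMul p C) (n k : ℕ) (q : ℝ) :
    partitionSum p (n + k) q =
      ∑ a ∈ posWords p n, ∑ b ∈ posWords p k, p (List.ofFn a ++ List.ofFn b) ^ q := by
  rw [partitionSum, ← Finset.sum_product']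
  refine (Finset.sum_equiv (Fin.appendEquiv n k) (fun x => ?_) fun x _ => ?_).symm
  · rw [Finset.mem_product, mem_posWords, mem_posWords, mem_posWords, Fin.appendEquiv]
    simp only [Equiv.coe_fn_mk, List.ofFn_fin_append]
    exact (hp.append_pos_iff _ _).symm
  · simp [Fin.appendEquiv, List.ofFn_fin_append]

/-- The logarithmic error `|q| log C` is the same for every pair of words, whatever the sign of `q`,
so it survives summation. -/
theorem abs_log_partitionSum_add_le (hp : IsQuasiMul p C) (q : ℝ) (n k : ℕ) :
    |Real.log (partitionSum p (n + k) q) - Real.log (partitionSum p n q) -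
      Real.log (partitionSum p k q)| ≤ |q| * Real.log C := by
  have hn := hp.partitionSum_pos n q
  have hk := hp.partitionSum_pos k q
  have hterm : ∀ a ∈ posWords p n, ∀ b ∈ posWords p k,
      Real.exp (-(|q| * Real.log C)) * (p (List.ofFn a) ^ q * p (List.ofFn b) ^ q) ≤
        p (List.ofFn a ++ List.ofFn b) ^ q ∧
      p (List.ofFn a ++ List.ofFn b) ^ q ≤
        Real.exp (|q| * Real.log C) * (p (List.ofFn a) ^ q * p (List.ofFn b) ^ q) := by
    intro a ha b hb
    rw [mem_posWords] at ha hb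
    have hab := (hp.append_pos_iff _ _).2 ⟨ha, hb⟩
    have h1 := hp.abs_log_append_le ha hb
    have h2 : |(Real.log (p (List.ofFn a ++ List.ofFn b)) - Real.log (p (List.ofFn a)) -
        Real.log (p (List.ofFn b))) * q| ≤ |q| * Real.log C := by
      rw [abs_mul, mul_comm]
      gcongr
    rw [abs_le] at h2
    rw [Real.rpow_def_of_pos ha, Real.rpow_def_of_pos hb, Real.rpow_def_of_pos hab,
      ← Real.exp_add, ← Real.exp_add, ← Real.exp_add, Real.exp_le_exp, Real.exp_le_exp]
    constructor <;> linarith [h2.1, h2.2]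
  have hlow : Real.exp (-(|q| * Real.log C)) * (partitionSum p n q * partitionSum p k q) ≤
      partitionSum p (n + k) q := by
    rw [hp.partitionSum_add, partitionSum, partitionSum, Finset.sum_mul_sum, Finset.mul_sum]
    refine Finset.sum_le_sum fun a ha => ?_
    rw [Finset.mul_sum]
    exact Finset.sum_le_sum fun b hb => (hterm a ha b hb).1
  have hup : partitionSum p (n + k) q ≤
      Real.exp (|q| * Real.log C) * (partitionSum p n q * partitionSum p k q) := by
    rw [hp.partitionSum_add, partitionSum, partitionSum, Finset.sum_mul_sum, Finset.mul_sum]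
    refine Finset.sum_le_sum fun a ha => ?_
    rw [Finset.mul_sum]
    exact Finset.sum_le_sum fun b hb => (hterm a ha b hb).2
  have h1 := Real.log_le_log (by positivity) hlow
  have h2 := Real.log_le_log (hp.partitionSum_pos _ _) hup
  rw [Real.log_mul (Real.exp_pos _).ne' (by positivity), Real.log_mul hn.ne' hk.ne',
    Real.log_exp] at h1 h2
  rw [abs_le]
  constructor <;> linarith

/-- The exponential moments of the deviation are controlled by the partition function. -/
theorem sum_mul_exp_deviation (h : ℝ) (n : ℕ) (q : ℝ) :
    ∑ a ∈ posWords p n, p (List.ofFn a) * Real.exp (q * deviation p h (List.ofFn a)) =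
      partitionSum p n (1 - q) * Real.exp (-(q * (n * h))) := by
  rw [partitionSum, Finset.sum_mul]
  refine Finset.sum_congr rfl fun a ha => ?_
  rw [mem_posWords] at ha
  conv_lhs => rw [← Real.exp_log ha]
  rw [Real.rpow_def_of_pos ha, ← Real.exp_add, ← Real.exp_add]
  simp only [deviation, List.length_ofFn]
  ring_nf

/-! ### Gaussian moments and deviations of order `√n` -/

variable {T : ℝ → ℝ} {h v : ℝ}

/-- The uniformity in `n` is what matters: it allows `q` to depend on `n`, as in `q = 1 - t/√n`. -/
theorem abs_log_partitionSum_sub_le (hp : IsQuasiMul p C)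
    (hT : ∀ q, Tendsto (fun n : ℕ => Real.log (partitionSum p n q) / n) atTop (𝓝 (T q)))
    (q : ℝ) (n : ℕ) : |Real.log (partitionSum p n q) - n * T q| ≤ |q| * Real.log C := by
  obtain ⟨L, hL, hL'⟩ :=
    exists_tendsto_div_of_quasiAdditive (u := fun n => Real.log (partitionSum p n q))
      (hp.abs_log_partitionSum_add_le q)
  rw [tendsto_nhds_unique (hT q) hL]
  exact hL' n

/-- The exponential moments of the deviation at the scale `√n` are Gaussian up to constants. -/
theorem eventually_abs_log_moment_le (hp : IsQuasiMul p C) (hv : 0 < v)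
    (hT : ∀ q, Tendsto (fun n : ℕ => Real.log (partitionSum p n q) / n) atTop (𝓝 (T q)))
    (hexp : (fun q : ℝ => T (1 - q) - (q * h + v / 2 * q ^ 2)) =o[𝓝 0] fun q : ℝ => q ^ 2)
    (t : ℝ) :
    ∀ᶠ n : ℕ in atTop, |Real.log (∑ a ∈ posWords p n, p (List.ofFn a) *
      Real.exp (t / √n * deviation p h (List.ofFn a))) - v / 2 * t ^ 2| ≤
        2 * Real.log C + v / 4 * t ^ 2 := by
  have hq : Tendsto (fun n : ℕ => t / √(n : ℝ)) atTop (𝓝 0) :=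
    Tendsto.div_atTop tendsto_const_nhds
      (Real.tendsto_sqrt_atTop.comp tendsto_natCast_atTop_atTop)
  -- The constant `v / 4` is half the Gaussian coefficient: since `n q² = t²`, a growth of `v/4 *
  -- t²` remains.
  have hev := hq.eventually (hexp.def (show 0 < v / 4 by positivity))
  have hsmall : ∀ᶠ n : ℕ in atTop, |t / √(n : ℝ)| < 1 := by
    have := hq.abs
    rw [abs_zero] at this
    exact this.eventually_lt_const one_pos
  filter_upwards [hev, hsmall, eventually_gt_atTop 0] with n h1 h2 hn
  have hn' : (0 : ℝ) < n := by exact_mod_cast hn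
  rw [sum_mul_exp_deviation, Real.log_mul (hp.partitionSum_pos _ _).ne' (Real.exp_pos _).ne',
    Real.log_exp]
  set q := t / √(n : ℝ) with hqdef
  have hq2 : n * q ^ 2 = t ^ 2 := by
    rw [hqdef, div_pow, Real.sq_sqrt hn'.le]
    field_simp
  have h3 := abs_le.1 (hp.abs_log_partitionSum_sub_le hT (1 - q) n)
  have h4 : |1 - q| * Real.log C ≤ 2 * Real.log C := by
    have : |1 - q| ≤ 2 := by
      rw [abs_le]; rw [abs_lt] at h2
      constructor <;> linarith
    exact mul_le_mul_of_nonneg_right this (Real.log_nonneg hp.one_le)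
  rw [Real.norm_eq_abs, Real.norm_eq_abs, abs_of_nonneg (sq_nonneg q), abs_le] at h1
  have h5 := mul_le_mul_of_nonneg_left h1.1 hn'.le
  have h6 := mul_le_mul_of_nonneg_left h1.2 hn'.le
  rw [abs_le]
  constructor <;> nlinarith

/-- With probability bounded below, the deviation exceeds `√n`, in either direction. -/
theorem exists_le_sum_deviation (hp : IsQuasiMul p C) (hv : 0 < v)
    (hT : ∀ q, Tendsto (fun n : ℕ => Real.log (partitionSum p n q) / n) atTop (𝓝 (T q)))
    (hexp : (fun q : ℝ => T (1 - q) - (q * h + v / 2 * q ^ 2)) =o[𝓝 0] fun q : ℝ => q ^ 2)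
    (ε : ℝ) (hε : ε ^ 2 = 1) :
    ∃ c : ℝ, 0 < c ∧ ∀ᶠ n : ℕ in atTop,
      c ≤ ∑ a ∈ posWords p n with √(n : ℝ) < ε * deviation p h (List.ofFn a), p (List.ofFn a) := by
  -- With `θ = t/√n` and `b = √n` one has `θ b = t`, so the moment must exceed `2 exp(t)`. Its
  -- logarithm is at least `v/4 * t² - 2 log C`, which wins for large `t`.
  obtain ⟨t, ht0, ht⟩ : ∃ t : ℝ, 0 < t ∧ Real.log 2 + t ≤ v / 4 * t ^ 2 - 2 * Real.log C := by
    have hC := Real.log_nonneg hp.one_le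
    have h2 := Real.log_nonneg (one_le_two : (1 : ℝ) ≤ 2)
    refine ⟨4 / v * (1 + Real.log 2 + 2 * Real.log C) + 1, by positivity, ?_⟩
    set t := 4 / v * (1 + Real.log 2 + 2 * Real.log C) + 1 with htd
    have h1 : v / 4 * t = 1 + Real.log 2 + 2 * Real.log C + v / 4 := by
      rw [htd]; field_simp
    have h3 : 1 ≤ t := by
      rw [htd]
      have : 0 ≤ 4 / v * (1 + Real.log 2 + 2 * Real.log C) := by positivity
      linarith
    nlinarith
  -- `K` bounds the logarithmic moment at the doubled parameter `2 ε t`, independently of `n`.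
  set K := 2 * Real.log C + (v / 2 + v / 4) * (2 * (ε * t)) ^ 2 with hK
  refine ⟨Real.exp (2 * t - K), Real.exp_pos _, ?_⟩
  filter_upwards [hp.eventually_abs_log_moment_le hv hT hexp (ε * t),
    hp.eventually_abs_log_moment_le hv hT hexp (2 * (ε * t)), eventually_gt_atTop 0]
    with n h1 h2 hn
  have hsq : (0 : ℝ) < √(n : ℝ) := Real.sqrt_pos.2 (by exact_mod_cast hn)
  have hpos : ∀ q : ℝ, 0 < ∑ a ∈ posWords p n, p (List.ofFn a) *
      Real.exp (q * deviation p h (List.ofFn a)) := by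
    intro q
    rw [sum_mul_exp_deviation]
    exact mul_pos (hp.partitionSum_pos _ _) (Real.exp_pos _)
  have hM := exp_sq_le_tail_mul_moment (posWords p n) (fun a => p (List.ofFn a))
    (fun a => ε * deviation p h (List.ofFn a)) (fun a _ => hp.nonneg _) (hp.sum_posWords n).le
    (θ := t / √n) (b := √n) (by positivity)
  rw [div_mul_cancel₀ _ hsq.ne'] at hM
  -- The sign `ε` is moved from the deviation to the parameter, so one moment estimate serves both
  -- directions.
  have e1 : ∀ x : ℝ, t / √n * (ε * x) = ε * t / √n * x := fun x => by ring
  have e2 : ∀ x : ℝ, 2 * (t / √n) * (ε * x) = 2 * (ε * t) / √n * x := fun x => by ring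
  simp only [e1, e2] at hM
  have hM' := hM (by
    rw [← Real.log_le_log_iff (by positivity) (hpos _), Real.log_mul two_ne_zero
      (Real.exp_pos _).ne', Real.log_exp]
    have := (abs_le.1 h1).1
    rw [mul_pow, hε] at this
    linarith)
  have hK2 : ∑ a ∈ posWords p n, p (List.ofFn a) *
      Real.exp (2 * (ε * t) / √n * deviation p h (List.ofFn a)) ≤ Real.exp K := by
    rw [← Real.log_le_iff_le_exp (hpos _)]
    have := (abs_le.1 h2).2
    rw [hK]
    linarith
  have hfin : Real.exp t ^ 2 ≤
      (∑ a ∈ posWords p n with √(n : ℝ) < ε * deviation p h (List.ofFn a), p (List.ofFn a)) *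
        Real.exp K :=
    hM'.trans (mul_le_mul_of_nonneg_left hK2 (Finset.sum_nonneg fun a _ => hp.nonneg _))
  rw [Real.exp_sub, div_le_iff₀ (Real.exp_pos _), two_mul, Real.exp_add, ← sq]
  exact hfin

open Classical in
/-- The same lower bound inside each cylinder. -/
theorem eventually_le_sum_append (hp : IsQuasiMul p C) {c : ℝ} {ε : ℝ} (hε : ε ^ 2 = 1)
    (hc : ∀ᶠ n : ℕ in atTop,
      c ≤ ∑ a ∈ posWords p n with √(n : ℝ) < ε * deviation p h (List.ofFn a), p (List.ofFn a))
    (u : List A) :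
    ∀ᶠ n : ℕ in atTop, c / C * p u ≤
      ∑ a ∈ posWords p n with 0 < p (u ++ List.ofFn a) ∧
        √((u.length + n : ℕ) : ℝ) / 2 < ε * deviation p h (u ++ List.ofFn a),
        p (u ++ List.ofFn a) := by
  have hC : 0 < C := zero_lt_one.trans_le hp.one_le
  rcases (hp.nonneg u).eq_or_lt with hu | hu
  · refine Eventually.of_forall fun n => ?_
    rw [← hu, mul_zero]
    exact Finset.sum_nonneg fun a _ => hp.nonneg _
  -- Half of `√n` absorbs the deviation of the prefix `u`, the error `log C` and the change from
  -- `√n` to `√(|u| + n)`.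
  have hlarge : ∀ᶠ n : ℕ in atTop,
      2 * (|deviation p h u| + Real.log C + √(u.length : ℝ) / 2) < √(n : ℝ) :=
    (Real.tendsto_sqrt_atTop.comp tendsto_natCast_atTop_atTop).eventually_gt_atTop _
  have hεabs : |ε| = 1 := by
    rw [← sq_eq_sq₀ (abs_nonneg _) zero_le_one, sq_abs, hε, one_pow]
  filter_upwards [hc, hlarge] with n h1 h2
  calc c / C * p u ≤ (∑ a ∈ posWords p n with √(n : ℝ) < ε * deviation p h (List.ofFn a),
        p (List.ofFn a)) / C * p u := by gcongr
    _ = ∑ a ∈ posWords p n with √(n : ℝ) < ε * deviation p h (List.ofFn a),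
          1 / C * (p u * p (List.ofFn a)) := by
        rw [Finset.sum_div, Finset.sum_mul]
        exact Finset.sum_congr rfl fun a _ => by ring
    _ ≤ ∑ a ∈ posWords p n with √(n : ℝ) < ε * deviation p h (List.ofFn a),
          p (u ++ List.ofFn a) := Finset.sum_le_sum fun a _ => hp.le_append _ _
    _ ≤ _ := by
        refine Finset.sum_le_sum_of_subset_of_nonneg (fun a ha => ?_) fun a _ _ => hp.nonneg _
        rw [Finset.mem_filter] at ha ⊢
        have ha0 := mem_posWords.1 ha.1
        refine ⟨ha.1, (hp.append_pos_iff _ _).2 ⟨hu, ha0⟩, ?_⟩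
        have hdev := hp.abs_deviation_append_le h hu ha0
        have h3 : |ε * (deviation p h (u ++ List.ofFn a) - deviation p h u -
            deviation p h (List.ofFn a))| ≤ Real.log C := by
          rw [abs_mul, hεabs, one_mul]; exact hdev
        have h4 : |ε * deviation p h u| = |deviation p h u| := by
          rw [abs_mul, hεabs, one_mul]
        have h5 := (abs_le.1 h3).1
        have h6 := neg_abs_le (ε * deviation p h u)
        rw [h4] at h6
        have h7 : √((u.length + n : ℕ) : ℝ) ≤ √(u.length : ℝ) + √(n : ℝ) := by
          push_cast
          exact Real.sqrt_le_iff.2 ⟨by positivity, by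
            nlinarith [Real.sq_sqrt (Nat.cast_nonneg (α := ℝ) u.length),
              Real.sq_sqrt (Nat.cast_nonneg (α := ℝ) n),
              mul_nonneg (Real.sqrt_nonneg (u.length : ℝ)) (Real.sqrt_nonneg (n : ℝ))]⟩
        linarith [ha.2]

/-- The growth rate at `1 - q` is nonpositive for `q ≤ 0`, which forces the drift to be
positive. -/
theorem drift_pos (hp : IsQuasiMul p C) (hv : 0 < v)
    (hT : ∀ q, Tendsto (fun n : ℕ => Real.log (partitionSum p n q) / n) atTop (𝓝 (T q)))
    (hexp : (fun q : ℝ => T (1 - q) - (q * h + v / 2 * q ^ 2)) =o[𝓝 0] fun q : ℝ => q ^ 2) :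
    0 < h := by
  have hev := hexp.def (show 0 < v / 4 by positivity)
  obtain ⟨q, hq, hq0⟩ :=
    ((hev.filter_mono nhdsWithin_le_nhds).and (self_mem_nhdsWithin (s := Set.Iio (0 : ℝ)))).exists
  have hq0 : q < 0 := hq0
  have hTle : T (1 - q) ≤ 0 := by
    refine le_of_tendsto (hT (1 - q)) (Eventually.of_forall fun n => ?_)
    refine div_nonpos_of_nonpos_of_nonneg
      (Real.log_nonpos (hp.partitionSum_pos _ _).le ?_) n.cast_nonneg
    refine le_trans (Finset.sum_le_sum fun a ha => ?_) (hp.sum_posWords n).le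
    have h1 : p (List.ofFn a) ≤ 1 := by
      rw [← hp.sum_eq_one n]
      exact Finset.single_le_sum (f := fun a : Fin n → A => p (List.ofFn a))
        (fun b _ => hp.nonneg _) (Finset.mem_univ a)
    calc p (List.ofFn a) ^ (1 - q) ≤ p (List.ofFn a) ^ (1 : ℝ) :=
          Real.rpow_le_rpow_of_exponent_ge (mem_posWords.1 ha) h1 (by linarith)
      _ = _ := Real.rpow_one _
  rw [Real.norm_eq_abs, Real.norm_eq_abs, abs_of_nonneg (sq_nonneg q), abs_le] at hq
  have hsq : 0 < q ^ 2 := sq_pos_of_neg hq0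
  -- If `h ≤ 0`, then `q < 0` gives `T (1 - q) ≥ q h + v/4 * q² > 0`, against `hTle`.
  by_contra hneg
  rw [not_lt] at hneg
  nlinarith [hq.1, mul_nonneg_of_nonpos_of_nonpos hq0.le hneg]

end IsQuasiMul

end QB

/-! ### Geometry of the cubes and the weights defined by the measure -/

namespace QB

theorem measurableSet_ladicCube (ℓ D n : ℕ) (k : Fin D → Fin (ℓ ^ n)) :
    MeasurableSet (ladicCube ℓ D n k) := by
  have : ladicCube ℓ D n k = ⋂ i, (fun x : EuclideanSpace ℝ (Fin D) => x i) ⁻¹'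
      Set.Ico (((k i : ℕ) : ℝ) / (ℓ : ℝ) ^ n) ((((k i : ℕ) : ℝ) + 1) / (ℓ : ℝ) ^ n) := by
    ext x
    simp [ladicCube]
  rw [this]
  exact MeasurableSet.iInter fun i => measurableSet_Ico.preimage (by fun_prop)

/-- A point of a cube determines its index. -/
theorem floor_eq_of_mem_ladicCube {ℓ D n : ℕ} (hℓ : 0 < ℓ) {k : Fin D → Fin (ℓ ^ n)}
    {x : EuclideanSpace ℝ (Fin D)} (hx : x ∈ ladicCube ℓ D n k) (i : Fin D) :
    ⌊x i * (ℓ : ℝ) ^ n⌋₊ = (k i : ℕ) := by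
  have hpos : (0 : ℝ) < (ℓ : ℝ) ^ n := by positivity
  have h := hx i
  rw [div_le_iff₀ hpos, lt_div_iff₀ hpos] at h
  rw [Nat.floor_eq_iff (le_trans (Nat.cast_nonneg _) h.1)]
  exact h

theorem ladicCube_index_unique {ℓ D n : ℕ} (hℓ : 0 < ℓ) {k k' : Fin D → Fin (ℓ ^ n)}
    {x : EuclideanSpace ℝ (Fin D)} (hx : x ∈ ladicCube ℓ D n k) (hx' : x ∈ ladicCube ℓ D n k') :
    k = k' :=
  funext fun i => Fin.ext <|
    (floor_eq_of_mem_ladicCube hℓ hx i).symm.trans (floor_eq_of_mem_ladicCube hℓ hx' i)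

theorem ladicCube_nonempty {ℓ D n : ℕ} (hℓ : 0 < ℓ) (k : Fin D → Fin (ℓ ^ n)) :
    (ladicCube ℓ D n k).Nonempty := by
  refine ⟨WithLp.toLp 2 fun i => ((k i : ℕ) : ℝ) / (ℓ : ℝ) ^ n, fun i => ⟨le_rfl, ?_⟩⟩
  have hpos : (0 : ℝ) < (ℓ : ℝ) ^ n := by positivity
  exact div_lt_div_of_pos_right (lt_add_one _) hpos

theorem ladicCube_injective {ℓ D n : ℕ} (hℓ : 0 < ℓ) : Function.Injective (ladicCube ℓ D n) := by
  intro k k' h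
  obtain ⟨x, hx⟩ := ladicCube_nonempty hℓ k
  exact ladicCube_index_unique hℓ hx (h ▸ hx)

theorem iUnion_ladicCube {ℓ : ℕ} (D n : ℕ) (hℓ : 0 < ℓ) :
    ⋃ k, ladicCube ℓ D n k = unitCube D := by
  have hpos : (0 : ℝ) < (ℓ : ℝ) ^ n := by positivity
  ext x
  rw [Set.mem_iUnion]
  constructor
  · rintro ⟨k, hk⟩ i
    have h := hk i
    rw [div_le_iff₀ hpos, lt_div_iff₀ hpos] at h
    have hk1 : (((k i : ℕ) : ℝ) + 1) ≤ (ℓ : ℝ) ^ n := by exact_mod_cast (k i).2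
    constructor
    · exact nonneg_of_mul_nonneg_left (le_trans (Nat.cast_nonneg _) h.1) hpos
    · nlinarith
  · intro hx
    have hlt : ∀ i, ⌊x i * (ℓ : ℝ) ^ n⌋₊ < ℓ ^ n := by
      intro i
      rw [Nat.floor_lt (mul_nonneg (hx i).1 hpos.le)]
      push_cast
      nlinarith [(hx i).2]
    refine ⟨fun i => ⟨⌊x i * (ℓ : ℝ) ^ n⌋₊, hlt i⟩, fun i => ?_⟩
    rw [div_le_iff₀ hpos, lt_div_iff₀ hpos]
    exact ⟨Nat.floor_le (mul_nonneg (hx i).1 hpos.le), Nat.lt_floor_add_one _⟩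

theorem dist_le_of_mem_ladicCube {ℓ D n : ℕ} (hℓ : 0 < ℓ) {k : Fin D → Fin (ℓ ^ n)}
    {x y : EuclideanSpace ℝ (Fin D)} (hx : x ∈ ladicCube ℓ D n k) (hy : y ∈ ladicCube ℓ D n k) :
    dist x y ≤ √D * ((ℓ : ℝ) ^ n)⁻¹ := by
  have hpos : (0 : ℝ) < (ℓ : ℝ) ^ n := by positivity
  rw [EuclideanSpace.dist_eq, Real.sqrt_le_left (by positivity), mul_pow,
    Real.sq_sqrt (Nat.cast_nonneg D)]
  calc ∑ i, dist (x i) (y i) ^ 2 ≤ ∑ _i : Fin D, (((ℓ : ℝ) ^ n)⁻¹) ^ 2 := by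
        refine Finset.sum_le_sum fun i _ => ?_
        have h1 := hx i
        have h2 := hy i
        rw [add_div, one_div] at h1 h2
        have : dist (x i) (y i) ≤ ((ℓ : ℝ) ^ n)⁻¹ := by
          rw [Real.dist_eq, abs_le]
          constructor <;> linarith [h1.1, h1.2, h2.1, h2.2]
        gcongr
    _ = _ := by simp

namespace IsCubeCoding

variable {ℓ D : ℕ} {I : List (Fin (ℓ ^ D)) → Set (EuclideanSpace ℝ (Fin D))}

/-- Non-empty disjoint cubes determine their indices, so words and multi-indices can be exchanged in
sums. -/
theorem exists_equiv (hI : IsCubeCoding ℓ D I) (hℓ : 0 < ℓ) (n : ℕ) :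
    ∃ e : (Fin n → Fin (ℓ ^ D)) ≃ (Fin D → Fin (ℓ ^ n)),
      ∀ a, I (List.ofFn a) = ladicCube ℓ D n (e a) := by
  have hex : ∀ a : Fin n → Fin (ℓ ^ D), ∃ k, ladicCube ℓ D n k = I (List.ofFn a) :=
    fun a => (hI.bijOn n).mapsTo (List.length_ofFn (f := a))
  choose f hf using hex
  refine ⟨Equiv.ofBijective f ⟨fun a b hab => ?_, fun k => ?_⟩, fun a => (hf a).symm⟩
  · have h1 : I (List.ofFn a) = I (List.ofFn b) := by rw [← hf a, ← hf b, hab]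
    exact List.ofFn_injective
      ((hI.bijOn n).injOn (List.length_ofFn (f := a)) (List.length_ofFn (f := b)) h1)
  · obtain ⟨w, hw, hwk⟩ := (hI.bijOn n).surjOn ⟨k, rfl⟩
    have hw : w.length = n := hw
    subst hw
    refine ⟨w.get, ladicCube_injective hℓ ?_⟩
    rw [hf, List.ofFn_get, hwk]

theorem exists_ladicCube_eq (hI : IsCubeCoding ℓ D I) (w : List (Fin (ℓ ^ D))) :
    ∃ k, I w = ladicCube ℓ D w.length k := by
  obtain ⟨k, hk⟩ := (hI.bijOn w.length).mapsTo (rfl : w.length = w.length)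
  exact ⟨k, hk.symm⟩

theorem measurableSet (hI : IsCubeCoding ℓ D I) (w : List (Fin (ℓ ^ D))) :
    MeasurableSet (I w) := by
  obtain ⟨k, hk⟩ := hI.exists_ladicCube_eq w
  rw [hk]
  exact measurableSet_ladicCube _ _ _ _

theorem eq_of_mem (hI : IsCubeCoding ℓ D I) (hℓ : 0 < ℓ) {w w' : List (Fin (ℓ ^ D))}
    (hlen : w.length = w'.length) {x : EuclideanSpace ℝ (Fin D)} (hx : x ∈ I w)
    (hx' : x ∈ I w') : w = w' := by
  obtain ⟨k, hk⟩ := hI.exists_ladicCube_eq w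
  obtain ⟨k', hk'⟩ := (hI.bijOn w.length).mapsTo (hlen.symm : w'.length = w.length)
  refine (hI.bijOn w.length).injOn rfl hlen.symm ?_
  rw [← hk'] at hx' ⊢
  rw [hk] at hx ⊢
  rw [ladicCube_index_unique hℓ hx hx']

theorem pairwise_disjoint (hI : IsCubeCoding ℓ D I) (hℓ : 0 < ℓ) (n : ℕ) :
    Pairwise (Function.onFun Disjoint fun a : Fin n → Fin (ℓ ^ D) => I (List.ofFn a)) := by
  intro a b hab
  refine Set.disjoint_left.2 fun x hx hx' => hab ?_
  exact List.ofFn_injective (hI.eq_of_mem hℓ (by simp) hx hx')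

theorem iUnion_eq (hI : IsCubeCoding ℓ D I) (hℓ : 0 < ℓ) (n : ℕ) :
    ⋃ a : Fin n → Fin (ℓ ^ D), I (List.ofFn a) = unitCube D := by
  obtain ⟨e, he⟩ := hI.exists_equiv hℓ n
  rw [← iUnion_ladicCube D n hℓ, ← e.surjective.iUnion_comp]
  exact Set.iUnion_congr he

theorem append_subset (hI : IsCubeCoding ℓ D I) (u v : List (Fin (ℓ ^ D))) :
    I (u ++ v) ⊆ I u := by
  induction v using List.reverseRecOn with
  | nil => simp
  | append_singleton v a ih =>
    rw [← List.append_assoc]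
    exact (hI.nested _ _).trans ih

theorem dist_le (hI : IsCubeCoding ℓ D I) (hℓ : 0 < ℓ) {w : List (Fin (ℓ ^ D))}
    {x y : EuclideanSpace ℝ (Fin D)} (hx : x ∈ I w) (hy : y ∈ I w) :
    dist x y ≤ √D * ((ℓ : ℝ) ^ w.length)⁻¹ := by
  obtain ⟨k, hk⟩ := hI.exists_ladicCube_eq w
  rw [hk] at hx hy
  exact dist_le_of_mem_ladicCube hℓ hx hy

theorem lqSpectrumAt_eq (hI : IsCubeCoding ℓ D I) (hℓ : 0 < ℓ)
    (m : Measure (EuclideanSpace ℝ (Fin D))) (n : ℕ) (q : ℝ) :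
    lqSpectrumAt ℓ m n q =
      Real.log (partitionSum (fun w => m.real (I w)) n q) / n / Real.log ℓ := by
  obtain ⟨e, he⟩ := hI.exists_equiv hℓ n
  classical
  rw [lqSpectrumAt, partitionSum, posWords, Finset.sum_filter, ← e.sum_comp]
  simp only [he]
  rw [div_div, one_div_mul_eq_div]

variable {m : Measure (EuclideanSpace ℝ (Fin D))} [IsProbabilityMeasure m]

theorem ae_mem_unitCube (hm : IsQuasiBernoulli I m) : ∀ᵐ x ∂m, x ∈ unitCube D := by
  have hmeas : MeasurableSet (unitCube D) := by
    -- In generation `0` the base plays no role; `1` is merely a positive choice.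
    rw [← iUnion_ladicCube (ℓ := 1) D 0 one_pos]
    exact MeasurableSet.iUnion fun k => measurableSet_ladicCube _ _ _ _
  exact (prob_compl_eq_zero_iff hmeas).2 hm.unitCube_eq_one

/-- The masses of the cubes form a quasi-multiplicative family of weights. -/
theorem exists_isQuasiMul (hI : IsCubeCoding ℓ D I) (hℓ : 0 < ℓ) (hm : IsQuasiBernoulli I m) :
    ∃ C, IsQuasiMul (fun w => m.real (I w)) C := by
  obtain ⟨C, hC, h⟩ := hm.quasiBernoulli
  refine ⟨C, hC, fun w => measureReal_nonneg, fun n => ?_, fun u v => (h u v).1,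
    fun u v => (h u v).2⟩
  rw [← measureReal_iUnion_fintype (hI.pairwise_disjoint hℓ n) (fun a => hI.measurableSet _),
    hI.iUnion_eq hℓ, measureReal_def, hm.unitCube_eq_one, ENNReal.toReal_one]

/-- The growth rates of the partition functions exist and define the spectrum. -/
theorem tendsto_log_partitionSum (hI : IsCubeCoding ℓ D I) (hℓ : 2 ≤ ℓ)
    (hm : IsQuasiBernoulli I m) (q : ℝ) :
    Tendsto (fun n : ℕ => Real.log (partitionSum (fun w => m.real (I w)) n q) / n) atTop
      (𝓝 (lqSpectrum ℓ m q * Real.log ℓ)) := by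
  have hlog : 0 < Real.log ℓ := Real.log_pos (by exact_mod_cast hℓ)
  obtain ⟨C, hC⟩ := hI.exists_isQuasiMul (by omega) hm
  obtain ⟨L, hL, -⟩ := exists_tendsto_div_of_quasiAdditive
    (u := fun n => Real.log (partitionSum (fun w => m.real (I w)) n q))
    (hC.abs_log_partitionSum_add_le q)
  have h1 : lqSpectrum ℓ m q = L / Real.log ℓ := by
    rw [lqSpectrum]
    simp only [hI.lqSpectrumAt_eq (by omega : 0 < ℓ) m]
    exact (hL.div_const _).limsup_eq
  rwa [h1, div_mul_cancel₀ _ hlog.ne']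

end IsCubeCoding

/-! ### From positive density in every cube to full measure -/

/-- A lower bound for the measures of infinitely many sets passes to their upper limit. -/
theorem le_measure_frequently_inter {X : Type*} [MeasurableSpace X] (μ : Measure X)
    [IsFiniteMeasure μ] {s : ℕ → Set X} (hs : ∀ n, MeasurableSet (s n)) {B : Set X}
    (hB : MeasurableSet B) {c : ℝ≥0∞} (hc : ∃ᶠ n in atTop, c ≤ μ (s n ∩ B)) :
    c ≤ μ ({x | ∃ᶠ n in atTop, x ∈ s n} ∩ B) := by
  have heq : {x | ∃ᶠ n in atTop, x ∈ s n} ∩ B = ⋂ N, ((⋃ n ≥ N, s n) ∩ B) := by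
    ext x
    simp only [Set.mem_inter_iff, Set.mem_ofPred_eq, frequently_atTop, Set.mem_iInter,
      Set.mem_iUnion, exists_prop]
    exact ⟨fun h N => ⟨h.1 N, h.2⟩, fun h => ⟨fun N => (h N).1, (h 0).2⟩⟩
  have hanti : Antitone fun N => (⋃ n ≥ N, s n) ∩ B := by
    intro N N' hN
    refine Set.inter_subset_inter_left _ ?_
    exact Set.biUnion_subset_biUnion_left fun n hn => le_trans hN hn
  rw [heq, hanti.measure_iInter
    (fun N => ((MeasurableSet.biUnion (Set.to_countable _) fun n _ => hs n).inter
      hB).nullMeasurableSet) ⟨0, measure_ne_top _ _⟩]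
  refine le_iInf fun N => ?_
  obtain ⟨n, hn, hcn⟩ := frequently_atTop.1 hc N
  exact hcn.trans (measure_mono (Set.inter_subset_inter_left _ (Set.subset_biUnion_of_mem hn)))

namespace IsCubeCoding

variable {ℓ D : ℕ} {I : List (Fin (ℓ ^ D)) → Set (EuclideanSpace ℝ (Fin D))}
variable {m : Measure (EuclideanSpace ℝ (Fin D))} [IsProbabilityMeasure m]

theorem tendsto_diam_bound (hℓ : 2 ≤ ℓ) :
    Tendsto (fun n : ℕ => √D * ((ℓ : ℝ) ^ n)⁻¹) atTop (𝓝 0) := by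
  have : Tendsto (fun n : ℕ => ((ℓ : ℝ) ^ n)⁻¹) atTop (𝓝 0) :=
    (tendsto_pow_atTop_atTop_of_one_lt (by exact_mod_cast hℓ)).inv_tendsto_atTop
  simpa using this.const_mul (√D)

/-- A lower bound for the density of a set in all cubes extends to the open sets. -/
theorem mul_measure_le_of_isOpen (hI : IsCubeCoding ℓ D I) (hℓ : 2 ≤ ℓ)
    (hm : IsQuasiBernoulli I m) {A : Set (EuclideanSpace ℝ (Fin D))} (hA : MeasurableSet A)
    {c : ℝ≥0∞} (hc : ∀ w, c * m (I w) ≤ m (A ∩ I w)) {U : Set (EuclideanSpace ℝ (Fin D))}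
    (hU : IsOpen U) : c * m U ≤ m (A ∩ U) := by
  classical
  have hℓ0 : 0 < ℓ := by omega
  let F : ∀ n : ℕ, Finset (Fin n → Fin (ℓ ^ D)) := fun n =>
    Finset.univ.filter fun a => I (List.ofFn a) ⊆ U
  let V : ℕ → Set (EuclideanSpace ℝ (Fin D)) := fun n => ⋃ a ∈ F n, I (List.ofFn a)
  have hVU : ∀ n, V n ⊆ U := fun n =>
    Set.iUnion₂_subset fun a ha => (Finset.mem_filter.1 ha).2
  have hdisj : ∀ n, (F n : Set (Fin n → Fin (ℓ ^ D))).PairwiseDisjoint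
      fun a => I (List.ofFn a) := fun n => (hI.pairwise_disjoint hℓ0 n).set_pairwise _
  have hV : ∀ n, c * m (V n) ≤ m (A ∩ U) := by
    intro n
    calc c * m (V n) = ∑ a ∈ F n, c * m (I (List.ofFn a)) := by
          rw [measure_biUnion_finset (hdisj n) fun a _ => hI.measurableSet _, Finset.mul_sum]
      _ ≤ ∑ a ∈ F n, m (A ∩ I (List.ofFn a)) := Finset.sum_le_sum fun a _ => hc _
      _ = m (⋃ a ∈ F n, A ∩ I (List.ofFn a)) := by
          rw [measure_biUnion_finset _ fun a _ => hA.inter (hI.measurableSet _)]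
          exact fun a ha b hb hab => (hdisj n ha hb hab).mono Set.inter_subset_right
            Set.inter_subset_right
      _ ≤ m (A ∩ U) := by
          refine measure_mono (Set.iUnion₂_subset fun a ha => ?_)
          exact Set.inter_subset_inter_right _ (Finset.mem_filter.1 ha).2
  have hlim : ∀ x ∈ U ∩ unitCube D, ∀ᶠ n in atTop, x ∈ V n := by
    rintro x ⟨hxU, hx⟩
    obtain ⟨r, hr, hball⟩ := Metric.isOpen_iff.1 hU x hxU
    filter_upwards [(tendsto_diam_bound (D := D) hℓ).eventually_lt_const hr] with n hn
    rw [← hI.iUnion_eq hℓ0 n, Set.mem_iUnion] at hx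
    obtain ⟨a, ha⟩ := hx
    refine Set.mem_biUnion (Finset.mem_coe.2 (Finset.mem_filter.2 ⟨Finset.mem_univ a, ?_⟩)) ha
    intro y hy
    refine hball ?_
    have := hI.dist_le hℓ0 hy ha
    rw [List.length_ofFn] at this
    exact Metric.mem_ball.2 (this.trans_lt hn)
  -- Each point of `U` in the unit cube lies in all `V n` from some rank on, so these tail
  -- intersections exhaust `U` almost everywhere.
  have hmono : Monotone fun N => ⋂ n ≥ N, V n := by
    intro N N' hN
    exact Set.biInter_subset_biInter_left fun n hn => le_trans hN hn
  have hUm : m U ≤ ⨆ N, m (⋂ n ≥ N, V n) := by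
    rw [← hmono.measure_iUnion]
    refine measure_mono_ae ?_
    filter_upwards [ae_mem_unitCube hm] with x hx hxU
    obtain ⟨N, hN⟩ := eventually_atTop.1 (hlim x ⟨hxU, hx⟩)
    exact Set.mem_iUnion.2 ⟨N, Set.mem_iInter₂.2 hN⟩
  calc c * m U ≤ c * ⨆ N, m (⋂ n ≥ N, V n) := by gcongr
    _ = ⨆ N, c * m (⋂ n ≥ N, V n) := ENNReal.mul_iSup ..
    _ ≤ m (A ∩ U) := iSup_le fun N => le_trans (by
        gcongr
        exact Set.biInter_subset_of_mem (le_refl N)) (hV N)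

/-- A set whose density in all cubes is bounded below has full measure. -/
theorem ae_mem_of_forall_cube (hI : IsCubeCoding ℓ D I) (hℓ : 2 ≤ ℓ)
    (hm : IsQuasiBernoulli I m) {A : Set (EuclideanSpace ℝ (Fin D))} (hA : MeasurableSet A)
    {c : ℝ≥0∞} (hc0 : c ≠ 0) (hc : ∀ w, c * m (I w) ≤ m (A ∩ I w)) :
    ∀ᵐ x ∂m, x ∈ A := by
  change m Aᶜ = 0
  by_contra hne
  -- Outer regularity gives an open `U ⊇ Aᶜ` with `m (A ∩ U) < c * m Aᶜ`, whereas the density bound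
  -- gives `m (A ∩ U) ≥ c * m U`.
  have hε : c * m Aᶜ ≠ 0 := mul_ne_zero hc0 hne
  obtain ⟨U, hAU, hU, -, hlt⟩ := hA.compl.exists_isOpen_sdiff_lt (measure_ne_top m _) hε
  have h1 := hI.mul_measure_le_of_isOpen hℓ hm hA hc hU
  have h2 : U \ Aᶜ = A ∩ U := by
    rw [Set.sdiff_eq, compl_compl, Set.inter_comm]
  rw [h2] at hlt
  exact absurd (h1.trans_lt hlt) (not_lt.2 (by gcongr))

/-- Almost every point lies in infinitely many cubes of large deviation, in either direction. -/
theorem ae_frequently_deviation (hI : IsCubeCoding ℓ D I) (hℓ : 2 ≤ ℓ)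
    (hm : IsQuasiBernoulli I m) {d σ : ℝ} (hσ : 0 < σ)
    (hτ : (fun q : ℝ => lqSpectrum ℓ m (1 - q) - (q * d + σ ^ 2 / 2 * q ^ 2))
      =o[𝓝 0] fun q : ℝ => q ^ 2) (ε : ℝ) (hε : ε ^ 2 = 1) :
    ∀ᵐ x ∂m, ∃ᶠ n : ℕ in atTop, ∃ a : Fin n → Fin (ℓ ^ D), x ∈ I (List.ofFn a) ∧
      0 < m.real (I (List.ofFn a)) ∧
      √(n : ℝ) / 2 < ε * deviation (fun w => m.real (I w)) (d * Real.log ℓ) (List.ofFn a) := by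
  classical
  have hℓ0 : 0 < ℓ := by omega
  have hlog : 0 < Real.log ℓ := Real.log_pos (by exact_mod_cast hℓ)
  obtain ⟨C, hC⟩ := hI.exists_isQuasiMul hℓ0 hm
  have hCpos : 0 < C := zero_lt_one.trans_le hC.one_le
  -- Since `T = τ log ℓ`, both the drift and the variance acquire the factor `log ℓ`.
  obtain ⟨c, hc, hev⟩ := hC.exists_le_sum_deviation (h := d * Real.log ℓ)
    (v := σ ^ 2 * Real.log ℓ) (by positivity) (hI.tendsto_log_partitionSum hℓ hm)
    ((hτ.const_mul_left (Real.log ℓ)).congr_left fun q => by ring) ε hε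
  let P : ∀ n : ℕ, (Fin n → Fin (ℓ ^ D)) → Prop := fun n a => 0 < m.real (I (List.ofFn a)) ∧
      √(n : ℝ) / 2 < ε * deviation (fun w => m.real (I w)) (d * Real.log ℓ) (List.ofFn a)
  let s : ℕ → Set (EuclideanSpace ℝ (Fin D)) := fun n =>
    ⋃ a ∈ {a : Fin n → Fin (ℓ ^ D) | P n a}, I (List.ofFn a)
  have hs : ∀ n, MeasurableSet (s n) := fun n =>
    MeasurableSet.biUnion (Set.to_countable _) fun a _ => hI.measurableSet _
  have hA : MeasurableSet {x | ∃ᶠ n in atTop, x ∈ s n} := by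
    have : {x | ∃ᶠ n in atTop, x ∈ s n} = limsup s atTop := by
      ext x; rw [mem_limsup_iff_frequently_mem]; rfl
    rw [this]
    exact MeasurableSet.measurableSet_limsup hs
  have key : ∀ w, ENNReal.ofReal (c / C) * m (I w) ≤ m ({x | ∃ᶠ n in atTop, x ∈ s n} ∩ I w) := by
    intro w
    refine le_measure_frequently_inter m hs (hI.measurableSet w) ?_
    have h1 := hC.eventually_le_sum_append hε hev w
    have h2 : ∀ᶠ n : ℕ in atTop, ENNReal.ofReal (c / C) * m (I w) ≤ m (s (w.length + n) ∩ I w) := by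
      filter_upwards [h1] with n hn
      set G := (posWords (fun w => m.real (I w)) n).filter fun a =>
        0 < m.real (I (w ++ List.ofFn a)) ∧ √((w.length + n : ℕ) : ℝ) / 2 <
          ε * deviation (fun w => m.real (I w)) (d * Real.log ℓ) (w ++ List.ofFn a)
      have h3 : ∑ a ∈ G, m.real (I (w ++ List.ofFn a)) =
          m.real (⋃ a ∈ G, I (w ++ List.ofFn a)) := by
        rw [measureReal_biUnion_finset _ fun a _ => hI.measurableSet _]
        intro a _ b _ hab
        refine Set.disjoint_left.2 fun x hx hx' => hab ?_
        exact List.ofFn_injective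
          (List.append_cancel_left (hI.eq_of_mem hℓ0 (by simp) hx hx'))
      rw [h3] at hn
      calc ENNReal.ofReal (c / C) * m (I w) = ENNReal.ofReal (c / C * m.real (I w)) := by
            rw [ENNReal.ofReal_mul (by positivity), ofReal_measureReal]
        _ ≤ ENNReal.ofReal (m.real (⋃ a ∈ G, I (w ++ List.ofFn a))) := ENNReal.ofReal_le_ofReal hn
        _ = m (⋃ a ∈ G, I (w ++ List.ofFn a)) := ofReal_measureReal (measure_ne_top _ _)
        _ ≤ _ := by
            refine measure_mono (Set.iUnion₂_subset fun a ha => ?_)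
            refine Set.subset_inter ?_ (hI.append_subset _ _)
            have hP := (Finset.mem_filter.1 ha).2
            have happ : w ++ List.ofFn a = List.ofFn (Fin.append w.get a) := by
              rw [List.ofFn_fin_append, List.ofFn_get]
            rw [happ] at hP ⊢
            exact Set.subset_biUnion_of_mem (u := fun a => I (List.ofFn a))
              (show Fin.append w.get a ∈ {a | P (w.length + n) a} from hP)
    exact (tendsto_add_atTop_nat w.length).frequently
      (h2.mono fun n hn => by rwa [add_comm] at hn).frequently
  have hfin := hI.ae_mem_of_forall_cube hℓ hm hA (by simpa using div_pos hc hCpos)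
    key
  filter_upwards [hfin] with x hx
  refine Frequently.mono hx fun n hn => ?_
  obtain ⟨a, ha, hxa⟩ := Set.mem_iUnion₂.1 hn
  exact ⟨a, hxa, ha.1, ha.2⟩

end IsCubeCoding

end QB

/-! ### Packing measure and light balls -/

namespace QB

theorem inv_pow_rpow_eq_exp {ℓ : ℕ} (hℓ : 0 < ℓ) (n : ℕ) (d : ℝ) :
    (((ℓ : ℝ) ^ n)⁻¹) ^ d = Real.exp (-(n * (d * Real.log ℓ))) := by
  have hpos : (0 : ℝ) < (ℓ : ℝ) := by exact_mod_cast hℓ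
  rw [Real.rpow_def_of_pos (by positivity), Real.log_inv, Real.log_pow]
  ring_nf

theorem tendsto_exp_neg_sqrt_mul {c : ℝ} (hc : 0 < c) (K : ℝ) :
    Tendsto (fun n : ℕ => K * Real.exp (-(√(n : ℝ) * c))) atTop (𝓝 0) := by
  have h1 : Tendsto (fun n : ℕ => √(n : ℝ) * c) atTop atTop :=
    (Real.tendsto_sqrt_atTop.comp tendsto_natCast_atTop_atTop).atTop_mul_const hc
  simpa using (Real.tendsto_exp_neg_atTop_nhds_zero.comp h1).const_mul K

theorem summable_exp_neg_sqrt_div_four :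
    Summable fun n : ℕ => Real.exp (-(√(n : ℝ) * (1 / 4))) := by
  -- The constant is `6144 = 4^4 * 4!`, from `x^4 / 4! ≤ exp x` at `x = √n / 4`.
  have hs : Summable fun n : ℕ => 6144 * (1 / (n : ℝ) ^ 2) :=
    (Real.summable_one_div_nat_pow.2 one_lt_two).mul_left _
  refine Summable.of_norm_bounded_eventually_nat hs ?_
  filter_upwards [eventually_gt_atTop 0] with n hn
  have hn' : (0 : ℝ) < n := by exact_mod_cast hn
  rw [Real.norm_eq_abs, abs_of_pos (Real.exp_pos _), Real.exp_neg, mul_one_div (6144 : ℝ)]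
  have h := Real.pow_div_factorial_le_exp (x := √(n : ℝ) * (1 / 4)) (by positivity) 4
  have h4 : (√(n : ℝ) * (1 / 4)) ^ 4 / (Nat.factorial 4 : ℝ) = (n : ℝ) ^ 2 / 6144 := by
    rw [mul_pow, show √(n : ℝ) ^ 4 = (√(n : ℝ) ^ 2) ^ 2 by ring, Real.sq_sqrt hn'.le]
    norm_num [Nat.factorial]
    ring
  rw [h4] at h
  calc (Real.exp (√(n : ℝ) * (1 / 4)))⁻¹ ≤ ((n : ℝ) ^ 2 / 6144)⁻¹ :=
        inv_anti₀ (by positivity) h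
    _ = 6144 / (n : ℝ) ^ 2 := inv_div _ _

/-- A set has measure zero if its packing pre-measure is finite and the measure of small balls
around its points is infinitely often negligible at the scale `r ^ s`. -/
theorem measure_eq_zero_of_packingPreMeasure_lt_top {X : Type*} [PseudoMetricSpace X]
    [TopologicalSpace.SeparableSpace X] [MeasurableSpace X] (μ : Measure X) {s : ℝ}
    (hμ : ∀ᵐ x ∂μ, ∀ η > (0 : ℝ), ∀ δ > (0 : ℝ), ∃ r, 0 < r ∧ r ≤ δ ∧
      μ (Metric.closedBall x (5 * r)) ≤ ENNReal.ofReal η * ENNReal.ofReal (2 * r) ^ s)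
    {E : Set X} (hE : packingPreMeasure s E < ∞) : μ E = 0 := by
  simp only [packingPreMeasure, iInf_lt_iff] at hE
  obtain ⟨δ, hδ, hfin⟩ := hE
  set G := {x | ∀ η > (0 : ℝ), ∀ δ > (0 : ℝ), ∃ r, 0 < r ∧ r ≤ δ ∧
      μ (Metric.closedBall x (5 * r)) ≤ ENNReal.ofReal η * ENNReal.ofReal (2 * r) ^ s} with hG
  have key : ∀ η > (0 : ℝ), μ (E ∩ G) ≤ ENNReal.ofReal η * packingAt s δ E := by
    intro η hη
    -- Vitali selects disjoint balls, admissible for `packingAt`, whose fivefold enlargements cover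
    -- `E ∩ G`. This is why the hypothesis weighs the ball of radius `5 r` against `(2 r)^s`.
    let t : Set (X × ℝ) := {p | p.1 ∈ E ∧ 0 < p.2 ∧ p.2 ≤ δ ∧
      μ (Metric.closedBall p.1 (5 * p.2)) ≤ ENNReal.ofReal η * ENNReal.ofReal (2 * p.2) ^ s}
    obtain ⟨u, hut, hdisj, hcov⟩ := Vitali.exists_disjoint_subfamily_covering_enlargement_closedBall
      t (fun p => p.1) (fun p => p.2) δ (fun p hp => hp.2.2.1) 5 (by norm_num)
    have hcount : u.Countable := by
      refine hdisj.countable_of_nonempty_interior fun p hp => ⟨p.1, ?_⟩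
      exact Metric.ball_subset_interior_closedBall (Metric.mem_ball_self (hut hp).2.1)
    have hsub : E ∩ G ⊆ ⋃ p ∈ u, Metric.closedBall p.1 (5 * p.2) := by
      rintro x ⟨hxE, hxG⟩
      obtain ⟨r, hr, hrδ, hrμ⟩ := hxG η hη δ hδ
      obtain ⟨p, hp, hsubp⟩ := hcov (x, r) ⟨hxE, hr, hrδ, hrμ⟩
      exact Set.mem_biUnion hp (hsubp (Metric.mem_closedBall_self hr.le))
    calc μ (E ∩ G) ≤ μ (⋃ p ∈ u, Metric.closedBall p.1 (5 * p.2)) := measure_mono hsub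
      _ ≤ ∑' p : u, μ (Metric.closedBall p.1.1 (5 * p.1.2)) := measure_biUnion_le μ hcount _
      _ ≤ ∑' p : u, ENNReal.ofReal η * ENNReal.ofReal (2 * p.1.2) ^ s :=
          ENNReal.tsum_le_tsum fun p => (hut p.2).2.2.2
      _ = ENNReal.ofReal η * ∑' p : u, ENNReal.ofReal (2 * p.1.2) ^ s := ENNReal.tsum_mul_left
      _ ≤ ENNReal.ofReal η * packingAt s δ E := by
          gcongr
          exact le_iSup₂_of_le u (fun p hp => ⟨(hut hp).1, (hut hp).2.1, (hut hp).2.2.1⟩)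
            (le_iSup_of_le hdisj le_rfl)
  have hzero : μ (E ∩ G) = 0 := by
    have hlim : Tendsto (fun η : ℝ => ENNReal.ofReal η * packingAt s δ E) (𝓝[>] 0) (𝓝 0) := by
      have h0 : Tendsto (fun η : ℝ => ENNReal.ofReal η) (𝓝[>] 0) (𝓝 0) := by
        have := (ENNReal.continuous_ofReal.tendsto 0).mono_left
          (nhdsWithin_le_nhds (s := Set.Ioi (0 : ℝ)))
        simpa using this
      simpa using ENNReal.Tendsto.mul_const h0 (Or.inr hfin.ne)
    refine le_antisymm (ge_of_tendsto hlim ?_) bot_le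
    filter_upwards [self_mem_nhdsWithin] with η hη using key η hη
  rw [← hzero]
  -- `E` need not be measurable, but it agrees almost everywhere with `E ∩ G`.
  refine measure_congr ?_
  filter_upwards [hμ] with x hx
  exact propext ⟨fun h => ⟨h, hx⟩, fun h => h.1⟩

/-- Finiteness of the infimum yields one countable cover whose pieces all have finite pre-measure.
-/
theorem measure_eq_zero_of_packingMeasure_lt_top {X : Type*} [PseudoMetricSpace X]
    [MeasurableSpace X] (μ : Measure X) {s : ℝ}
    (hμ : ∀ E : Set X, packingPreMeasure s E < ∞ → μ E = 0)
    {E : Set X} (hE : packingMeasure X s E < ∞) : μ E = 0 := by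
  rw [packingMeasure, OuterMeasure.ofFunction_apply] at hE
  simp only [iInf_lt_iff] at hE
  obtain ⟨t, ht, hsum⟩ := hE
  refine measure_mono_null ht (measure_iUnion_null fun n => hμ _ ?_)
  exact (ENNReal.le_tsum n).trans_lt hsum

/-- A neighborhood of the cube of index `k`, containing the balls of radius `ℓ ^ (-n)` centred in
this cube. -/
def cubeNeighborhood (ℓ D n : ℕ) (k : Fin D → Fin (ℓ ^ n)) : Set (EuclideanSpace ℝ (Fin D)) :=
  {y | ∀ i, |y i * (ℓ : ℝ) ^ n - ((k i : ℕ) : ℝ)| ≤ 2}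

theorem measurableSet_cubeNeighborhood (ℓ D n : ℕ) (k : Fin D → Fin (ℓ ^ n)) :
    MeasurableSet (cubeNeighborhood ℓ D n k) := by
  have : cubeNeighborhood ℓ D n k = ⋂ i, (fun y : EuclideanSpace ℝ (Fin D) =>
      |y i * (ℓ : ℝ) ^ n - ((k i : ℕ) : ℝ)|) ⁻¹' Set.Iic 2 := by
    ext x
    simp [cubeNeighborhood]
  rw [this]
  exact MeasurableSet.iInter fun i => measurableSet_Iic.preimage (by fun_prop)

theorem closedBall_subset_cubeNeighborhood {ℓ D n : ℕ} (hℓ : 0 < ℓ) {k : Fin D → Fin (ℓ ^ n)}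
    {x : EuclideanSpace ℝ (Fin D)} (hx : x ∈ ladicCube ℓ D n k) :
    Metric.closedBall x ((ℓ : ℝ) ^ n)⁻¹ ⊆ cubeNeighborhood ℓ D n k := by
  intro y hy i
  have hpos : (0 : ℝ) < (ℓ : ℝ) ^ n := by positivity
  have h1 := hx i
  rw [div_le_iff₀ hpos, lt_div_iff₀ hpos] at h1
  have h2 : |y i - x i| ≤ ((ℓ : ℝ) ^ n)⁻¹ := by
    have h3 := PiLp.norm_apply_le (y - x) i
    rw [← dist_eq_norm] at h3
    exact h3.trans (Metric.mem_closedBall.1 hy)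
  have h4 : |y i * (ℓ : ℝ) ^ n - x i * (ℓ : ℝ) ^ n| ≤ 1 := by
    rw [← sub_mul, abs_mul, abs_of_pos hpos]
    calc _ ≤ ((ℓ : ℝ) ^ n)⁻¹ * (ℓ : ℝ) ^ n := by gcongr
      _ = 1 := inv_mul_cancel₀ hpos.ne'
  -- In units of `ℓ^(-n)`, `x` is offset from the corner by `[0, 1)` and `y` from `x` by at most
  -- `1`.
  rw [abs_le] at h4 ⊢
  constructor <;> linarith [h4.1, h4.2]

/-- A closed interval of length `4` contains at most five integers; this gives the overlap `5 ^ D`.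
-/
theorem card_filter_abs_sub_le (N : ℕ) (z : ℝ) :
    (Finset.univ.filter fun k : Fin N => |z - ((k : ℕ) : ℝ)| ≤ 2).card ≤ 5 := by
  have hinj : Function.Injective fun k : Fin N => ((k : ℕ) : ℤ) := fun a b h =>
    Fin.ext (Int.ofNat.inj h)
  calc _ = ((Finset.univ.filter fun k : Fin N => |z - ((k : ℕ) : ℝ)| ≤ 2).image
        fun k : Fin N => ((k : ℕ) : ℤ)).card := (Finset.card_image_of_injective _ hinj).symm
    _ ≤ (Finset.Icc (⌈z⌉ - 2) (⌊z⌋ + 2)).card := by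
        refine Finset.card_le_card fun j hj => ?_
        obtain ⟨k, hk, rfl⟩ := Finset.mem_image.1 hj
        have hk := abs_le.1 (Finset.mem_filter.1 hk).2
        rw [Finset.mem_Icc]
        constructor
        · rw [sub_le_iff_le_add, Int.ceil_le]
          push_cast
          linarith [hk.2]
        · rw [← sub_le_iff_le_add, Int.le_floor]
          push_cast
          linarith [hk.1]
    _ ≤ 5 := by
        rw [Int.card_Icc]
        have := Int.floor_le_ceil z
        omega

/-- The neighborhoods of the cubes of one generation have bounded overlap. -/
theorem sum_measure_cubeNeighborhood_le (ℓ D n : ℕ) (m : Measure (EuclideanSpace ℝ (Fin D)))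
    [IsProbabilityMeasure m] : ∑ k, m (cubeNeighborhood ℓ D n k) ≤ (5 : ℝ≥0∞) ^ D := by
  classical
  calc ∑ k, m (cubeNeighborhood ℓ D n k)
      = ∑ k, ∫⁻ y, (cubeNeighborhood ℓ D n k).indicator 1 y ∂m := by
        refine Finset.sum_congr rfl fun k _ => ?_
        rw [lintegral_indicator_one (measurableSet_cubeNeighborhood _ _ _ _)]
    _ = ∫⁻ y, ∑ k, (cubeNeighborhood ℓ D n k).indicator 1 y ∂m :=
        (lintegral_finsetSum _ fun k _ =>
          measurable_one.indicator (measurableSet_cubeNeighborhood _ _ _ _)).symm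
    _ ≤ ∫⁻ _, (5 : ℝ≥0∞) ^ D ∂m := by
        refine lintegral_mono fun y => ?_
        have hcard : (Finset.univ.filter fun k => y ∈ cubeNeighborhood ℓ D n k).card ≤ 5 ^ D := by
          have : (Finset.univ.filter fun k => y ∈ cubeNeighborhood ℓ D n k) =
              Fintype.piFinset fun i => Finset.univ.filter fun k : Fin (ℓ ^ n) =>
                |y i * (ℓ : ℝ) ^ n - ((k : ℕ) : ℝ)| ≤ 2 := by
            ext k
            simp only [Finset.mem_filter_univ, Fintype.mem_piFinset]
            rfl
          rw [this, Fintype.card_piFinset]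
          calc _ ≤ ∏ _i : Fin D, 5 :=
                Finset.prod_le_prod' fun i _ => card_filter_abs_sub_le _ _
            _ = 5 ^ D := by simp
        simp only [Set.indicator_apply, Pi.one_apply, Finset.sum_boole]
        exact_mod_cast hcard
    _ = 5 ^ D := by simp

namespace IsCubeCoding

variable {ℓ D : ℕ} {I : List (Fin (ℓ ^ D)) → Set (EuclideanSpace ℝ (Fin D))}
variable {m : Measure (EuclideanSpace ℝ (Fin D))} [IsProbabilityMeasure m]

/-- For almost every point, the cubes around it eventually carry a mass comparable, up to a
subexponential factor, to that of the balls of the same size. -/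
theorem ae_eventually_ball_le (hI : IsCubeCoding ℓ D I) (hℓ : 0 < ℓ) :
    ∀ᵐ x ∂m, ∀ᶠ n : ℕ in atTop, ∀ a : Fin n → Fin (ℓ ^ D), x ∈ I (List.ofFn a) →
      m.real (Metric.closedBall x ((ℓ : ℝ) ^ n)⁻¹) * Real.exp (-(√(n : ℝ) * (1 / 4))) ≤
        m.real (I (List.ofFn a)) := by
  classical
  let s : ℕ → Set (EuclideanSpace ℝ (Fin D)) := fun n =>
    {x | ∃ a : Fin n → Fin (ℓ ^ D), x ∈ I (List.ofFn a) ∧ m.real (I (List.ofFn a)) <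
      m.real (Metric.closedBall x ((ℓ : ℝ) ^ n)⁻¹) * Real.exp (-(√(n : ℝ) * (1 / 4)))}
  -- Bad points lie in cubes much lighter than their neighborhoods; bounded overlap makes the total
  -- mass of these cubes summable in `n`.
  have hs : ∀ n, m (s n) ≤ ENNReal.ofReal (5 ^ D * Real.exp (-(√(n : ℝ) * (1 / 4)))) := by
    intro n
    obtain ⟨e, he⟩ := hI.exists_equiv hℓ n
    set x0 := Real.exp (-(√(n : ℝ) * (1 / 4))) with hx0
    have hx0pos : 0 < x0 := Real.exp_pos _
    let F := Finset.univ.filter fun k : Fin D → Fin (ℓ ^ n) =>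
      m.real (ladicCube ℓ D n k) ≤ m.real (cubeNeighborhood ℓ D n k) * x0
    have hsub : s n ⊆ ⋃ k ∈ F, ladicCube ℓ D n k := by
      rintro x ⟨a, hxa, hlt⟩
      rw [he a] at hxa hlt
      refine Set.mem_biUnion (Finset.mem_coe.2 (Finset.mem_filter.2 ⟨Finset.mem_univ (e a), ?_⟩))
        hxa
      refine hlt.le.trans (mul_le_mul_of_nonneg_right ?_ hx0pos.le)
      exact measureReal_mono (closedBall_subset_cubeNeighborhood hℓ hxa)
    calc m (s n) ≤ ∑ k ∈ F, m (ladicCube ℓ D n k) :=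
          (measure_mono hsub).trans (measure_biUnion_finset_le _ _)
      _ ≤ ∑ k ∈ F, m (cubeNeighborhood ℓ D n k) * ENNReal.ofReal x0 := by
          refine Finset.sum_le_sum fun k hk => ?_
          have := ENNReal.ofReal_le_ofReal (Finset.mem_filter.1 hk).2
          rwa [ENNReal.ofReal_mul measureReal_nonneg, ofReal_measureReal (measure_ne_top _ _),
            ofReal_measureReal (measure_ne_top _ _)] at this
      _ ≤ ∑ k, m (cubeNeighborhood ℓ D n k) * ENNReal.ofReal x0 :=
          Finset.sum_le_sum_of_subset (Finset.subset_univ _)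
      _ ≤ 5 ^ D * ENNReal.ofReal x0 := by
          rw [← Finset.sum_mul]
          gcongr
          exact sum_measure_cubeNeighborhood_le ℓ D n m
      _ = _ := by
          rw [ENNReal.ofReal_mul (by positivity), ENNReal.ofReal_pow (by norm_num)]
          norm_num
  have hsum : ∑' n, m (s n) ≠ ∞ := by
    refine ne_top_of_le_ne_top ?_ (ENNReal.tsum_le_tsum hs)
    rw [← ENNReal.ofReal_tsum_of_nonneg (fun n => by positivity)
      (summable_exp_neg_sqrt_div_four.mul_left _)]
    exact ENNReal.ofReal_ne_top
  filter_upwards [ae_eventually_notMem hsum] with x hx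
  filter_upwards [hx] with n hn a ha
  by_contra hlt
  exact hn ⟨a, ha, not_le.1 hlt⟩

/-- At almost every point, small balls are infinitely often much lighter than `r ^ d`. -/
theorem ae_exists_ball_le (hI : IsCubeCoding ℓ D I) (hℓ : 2 ≤ ℓ)
    (hm : IsQuasiBernoulli I m) {d σ : ℝ} (hσ : 0 < σ)
    (hτ : (fun q : ℝ => lqSpectrum ℓ m (1 - q) - (q * d + σ ^ 2 / 2 * q ^ 2))
      =o[𝓝 0] fun q : ℝ => q ^ 2) :
    ∀ᵐ x ∂m, ∀ η > (0 : ℝ), ∀ δ > (0 : ℝ), ∃ r, 0 < r ∧ r ≤ δ ∧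
      m (Metric.closedBall x (5 * r)) ≤ ENNReal.ofReal η * ENNReal.ofReal (2 * r) ^ d := by
  have hℓ0 : 0 < ℓ := by omega
  filter_upwards [hI.ae_frequently_deviation hℓ hm hσ hτ 1 (one_pow 2),
    hI.ae_eventually_ball_le (m := m) hℓ0] with x hx1 hx2 η hη δ hδ
  have hr0 : Tendsto (fun n : ℕ => ((ℓ : ℝ) ^ n)⁻¹) atTop (𝓝 0) :=
    (tendsto_pow_atTop_atTop_of_one_lt (by exact_mod_cast hℓ)).inv_tendsto_atTop
  -- Of the gain `exp(-√n/2)`, one half pays for passing from cube to ball, the other beats `(5/2)^d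
  -- / η`.
  obtain ⟨n, ⟨a, hxa, hpos, hdev⟩, hball, hsmall, hη'⟩ := (hx1.and_eventually (hx2.and
    ((hr0.eventually_lt_const hδ).and
      ((tendsto_exp_neg_sqrt_mul (c := 1 / 4) (by norm_num) ((5 / 2) ^ d)).eventually_lt_const
        hη)))).exists
  set R := ((ℓ : ℝ) ^ n)⁻¹ with hR
  have hRpos : 0 < R := by positivity
  refine ⟨R / 5, by positivity, by linarith, ?_⟩
  rw [show 5 * (R / 5) = R by ring, ENNReal.ofReal_rpow_of_pos (by positivity),
    ← ENNReal.ofReal_mul hη.le, ← ofReal_measureReal (measure_ne_top m _)]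
  refine ENNReal.ofReal_le_ofReal ?_
  have hcube : m.real (I (List.ofFn a)) ≤
      Real.exp (-(√(n : ℝ) * (1 / 4))) ^ 2 * R ^ d := by
    rw [hR, inv_pow_rpow_eq_exp hℓ0, ← Real.log_le_log_iff hpos (by positivity),
      Real.log_mul (by positivity) (by positivity), Real.log_pow, Real.log_exp, Real.log_exp]
    rw [deviation, List.length_ofFn] at hdev
    push_cast
    linarith
  have hexp : 0 < Real.exp (-(√(n : ℝ) * (1 / 4))) := Real.exp_pos _
  have h1 : m.real (Metric.closedBall x R) ≤ Real.exp (-(√(n : ℝ) * (1 / 4))) * R ^ d := by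
    have h2 := (hball a hxa).trans hcube
    rw [sq, mul_assoc, mul_comm] at h2
    exact le_of_mul_le_mul_left h2 hexp
  have h3 : R ^ d = (5 / 2) ^ d * (2 * (R / 5)) ^ d := by
    rw [← Real.mul_rpow (by norm_num) (by positivity)]
    congr 1
    ring
  rw [h3] at h1
  calc _ ≤ _ := h1
    _ = ((5 / 2) ^ d * Real.exp (-(√(n : ℝ) * (1 / 4)))) * (2 * (R / 5)) ^ d := by ring
    _ ≤ η * (2 * (R / 5)) ^ d := by gcongr

/-! ### Hausdorff measure and heavy cubes -/

/-- A set covered infinitely often by heavy cubes is negligible for the Hausdorff measure. -/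
theorem hausdorffMeasure_eq_zero (hI : IsCubeCoding ℓ D I) (hℓ : 2 ≤ ℓ) {d : ℝ} (hd : 0 < d)
    {E : Set (EuclideanSpace ℝ (Fin D))}
    (hE : ∀ x ∈ E, ∃ᶠ n : ℕ in atTop, ∃ w, w.length = n ∧ x ∈ I w ∧
      (((ℓ : ℝ) ^ n)⁻¹) ^ d ≤ Real.exp (-(√(n : ℝ) * (1 / 2))) * m.real (I w)) :
    Measure.hausdorffMeasure d E = 0 := by
  classical
  have hℓ0 : 0 < ℓ := by omega
  let Q : List (Fin (ℓ ^ D)) → Prop := fun w => (((ℓ : ℝ) ^ w.length)⁻¹) ^ d ≤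
    Real.exp (-(√(w.length : ℝ) * (1 / 2))) * m.real (I w)
  -- A stopping rule: only the first heavy word of length at least `N` on each branch is kept, which
  -- makes the cubes disjoint.
  let G : ℕ → List (Fin (ℓ ^ D)) → Prop := fun N w => N ≤ w.length ∧ Q w ∧
    ∀ w', w' <+: w → N ≤ w'.length → w'.length < w.length → ¬ Q w'
  let t : ℕ → List (Fin (ℓ ^ D)) → Set (EuclideanSpace ℝ (Fin D)) := fun N w =>
    if G N w then I w else ∅
  have hdiam : ∀ w, Metric.ediam (I w) ≤ ENNReal.ofReal (√D * ((ℓ : ℝ) ^ w.length)⁻¹) := by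
    intro w
    refine Metric.ediam_le fun x hx y hy => ?_
    rw [edist_dist]
    exact ENNReal.ofReal_le_ofReal (hI.dist_le hℓ0 hx hy)
  have hmem : ∀ {N w x}, x ∈ t N w → G N w ∧ x ∈ I w := by
    intro N w x hx
    by_cases hG : G N w
    · exact ⟨hG, by simpa [t, hG] using hx⟩
    · simp [t, hG] at hx
  have hdisj : ∀ N, Pairwise (Function.onFun Disjoint (t N)) := by
    intro N
    have haux : ∀ w w' : List (Fin (ℓ ^ D)), w.length ≤ w'.length → ∀ x, x ∈ t N w →
        x ∈ t N w' → w = w' := by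
      intro w w' hlen x hx hx'
      obtain ⟨hG, hx⟩ := hmem hx
      obtain ⟨hG', hx'⟩ := hmem hx'
      have hpre : w = w'.take w.length := by
        refine hI.eq_of_mem hℓ0 (by simp [hlen]) hx ?_
        refine hI.append_subset _ (w'.drop w.length) ?_
        rwa [List.take_append_drop]
      have hpre' : w <+: w' := by
        rw [hpre]
        exact List.take_prefix _ _
      by_contra hne
      refine hG'.2.2 w hpre' hG.1 (lt_of_le_of_ne hlen fun h => hne ?_) hG.2.1
      exact hpre'.eq_of_length h
    intro w w' hne
    refine Set.disjoint_left.2 fun x hx hx' => ?_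
    rcases le_total w.length w'.length with h | h
    · exact hne (haux w w' h x hx hx')
    · exact hne (haux w' w h x hx' hx).symm
  have hcover : ∀ N, E ⊆ ⋃ w, t N w := by
    intro N x hx
    have hex : ∃ n, N ≤ n ∧ ∃ w, w.length = n ∧ x ∈ I w ∧ Q w := by
      obtain ⟨n, hn, w, hw, hxw, hQ⟩ := frequently_atTop.1 (hE x hx) N
      subst hw
      exact ⟨_, hn, w, rfl, hxw, hQ⟩
    obtain ⟨hN, w, hw, hxw, hQ⟩ := Nat.find_spec hex
    have hG : G N w := by
      refine ⟨hw ▸ hN, hQ, fun w' hpre hN' hlt hQ' => ?_⟩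
      rw [hw] at hlt
      refine Nat.find_min hex hlt ⟨hN', w', rfl, ?_, hQ'⟩
      obtain ⟨v, rfl⟩ := hpre
      exact hI.append_subset _ _ hxw
    exact Set.mem_iUnion.2 ⟨w, by simpa [t, hG] using hxw⟩
  have htdiam : ∀ N w, Metric.ediam (t N w) ≤ ENNReal.ofReal (√D * ((ℓ : ℝ) ^ N)⁻¹) := by
    intro N w
    by_cases hG : G N w
    · simp only [t, if_pos hG]
      refine (hdiam w).trans (ENNReal.ofReal_le_ofReal ?_)
      have h1 : (1 : ℝ) ≤ ℓ := by exact_mod_cast hℓ0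
      have h2 := hG.1
      gcongr
    · simp [t, hG]
  -- For selected cubes `diam^d` is at most `√D^d exp(-√N/2)` times the mass, and disjointness
  -- bounds the total mass by `1`.
  have hsum : ∀ N, ∑' w, Metric.ediam (t N w) ^ d ≤
      ENNReal.ofReal (√D ^ d * Real.exp (-(√(N : ℝ) * (1 / 2)))) := by
    intro N
    set K := √D ^ d * Real.exp (-(√(N : ℝ) * (1 / 2))) with hK
    have hterm : ∀ w, Metric.ediam (t N w) ^ d ≤ ENNReal.ofReal K * m (t N w) := by
      intro w
      by_cases hG : G N w
      · simp only [t, if_pos hG]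
        calc Metric.ediam (I w) ^ d
            ≤ ENNReal.ofReal (√D * ((ℓ : ℝ) ^ w.length)⁻¹) ^ d := by
              gcongr
              exact hdiam w
          _ = ENNReal.ofReal (√D ^ d * (((ℓ : ℝ) ^ w.length)⁻¹) ^ d) := by
              rw [ENNReal.ofReal_rpow_of_nonneg (by positivity) hd.le,
                Real.mul_rpow (by positivity) (by positivity)]
          _ ≤ ENNReal.ofReal (K * m.real (I w)) := by
              refine ENNReal.ofReal_le_ofReal ?_
              rw [hK, mul_assoc]
              refine mul_le_mul_of_nonneg_left (hG.2.1.trans ?_) (by positivity)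
              have h2 : (N : ℝ) ≤ w.length := by exact_mod_cast hG.1
              gcongr
          _ = ENNReal.ofReal K * m (I w) := by
              rw [ENNReal.ofReal_mul (by positivity), ofReal_measureReal (measure_ne_top _ _)]
      -- Unselected words give `0 ^ d`, which vanishes because `d > 0`.
      · simp [t, hG, hd]
    calc ∑' w, Metric.ediam (t N w) ^ d ≤ ∑' w, ENNReal.ofReal K * m (t N w) :=
          ENNReal.tsum_le_tsum hterm
      _ = ENNReal.ofReal K * m (⋃ w, t N w) := by
          rw [ENNReal.tsum_mul_left, measure_iUnion (hdisj N)]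
          intro w
          by_cases hG : G N w
          · simpa [t, hG] using hI.measurableSet w
          · simp [t, hG]
      _ ≤ ENNReal.ofReal K := mul_le_of_le_one_right' prob_le_one
  have hofReal : ∀ {f : ℕ → ℝ}, Tendsto f atTop (𝓝 0) →
      Tendsto (fun n => ENNReal.ofReal (f n)) atTop (𝓝 0) := by
    intro f hf
    simpa using ENNReal.tendsto_ofReal hf
  have hle := Measure.hausdorffMeasure_le_liminf_tsum d E (l := atTop)
    (fun N => ENNReal.ofReal (√D * ((ℓ : ℝ) ^ N)⁻¹)) (hofReal (tendsto_diam_bound hℓ)) t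
    (Eventually.of_forall htdiam) (Eventually.of_forall hcover)
  refine le_antisymm (hle.trans ?_) bot_le
  calc _ ≤ liminf (fun N : ℕ => ENNReal.ofReal (√D ^ d * Real.exp (-(√(N : ℝ) * (1 / 2))))) atTop :=
        liminf_le_liminf (Eventually.of_forall hsum)
    _ = 0 := (hofReal (tendsto_exp_neg_sqrt_mul (by norm_num) _)).liminf_eq

theorem dimension_pos (hI : IsCubeCoding ℓ D I) (hℓ : 2 ≤ ℓ)
    (hm : IsQuasiBernoulli I m) {d σ : ℝ} (hσ : 0 < σ)
    (hτ : (fun q : ℝ => lqSpectrum ℓ m (1 - q) - (q * d + σ ^ 2 / 2 * q ^ 2))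
      =o[𝓝 0] fun q : ℝ => q ^ 2) : 0 < d := by
  have hlog : 0 < Real.log ℓ := Real.log_pos (by exact_mod_cast hℓ)
  obtain ⟨C, hC⟩ := hI.exists_isQuasiMul (by omega) hm
  have := hC.drift_pos (h := d * Real.log ℓ) (v := σ ^ 2 * Real.log ℓ) (by positivity)
    (hI.tendsto_log_partitionSum hℓ hm)
    ((hτ.const_mul_left (Real.log ℓ)).congr_left fun q => by ring)
  exact pos_of_mul_pos_left this hlog.le

theorem exists_measurableSet_hausdorffMeasure_eq_zero (hI : IsCubeCoding ℓ D I) (hℓ : 2 ≤ ℓ)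
    (hm : IsQuasiBernoulli I m) {d σ : ℝ} (hσ : 0 < σ)
    (hτ : (fun q : ℝ => lqSpectrum ℓ m (1 - q) - (q * d + σ ^ 2 / 2 * q ^ 2))
      =o[𝓝 0] fun q : ℝ => q ^ 2) :
    ∃ E : Set (EuclideanSpace ℝ (Fin D)),
      MeasurableSet E ∧ m E = 1 ∧ Measure.hausdorffMeasure d E = 0 := by
  have hℓ0 : 0 < ℓ := by omega
  -- The exceptional set is enlarged to a measurable null set so that its complement is Borel; `ε =
  -- -1` selects the heavy cubes.
  obtain ⟨t, hsub, htm, ht0⟩ := exists_measurable_superset_of_null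
    (hI.ae_frequently_deviation hℓ hm hσ hτ (-1) (by norm_num))
  refine ⟨tᶜ, htm.compl, (prob_compl_eq_one_iff htm).2 ht0, ?_⟩
  refine hI.hausdorffMeasure_eq_zero (m := m) hℓ (hI.dimension_pos hℓ hm hσ hτ) fun x hx => ?_
  have hx' := not_not.1 fun h => hx (hsub h)
  refine Frequently.mono hx' ?_
  rintro n ⟨a, hxa, hpos, hdev⟩
  refine ⟨List.ofFn a, List.length_ofFn, hxa, ?_⟩
  rw [inv_pow_rpow_eq_exp hℓ0, ← Real.log_le_log_iff (by positivity) (by positivity),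
    Real.log_mul (by positivity) hpos.ne', Real.log_exp, Real.log_exp]
  rw [deviation, List.length_ofFn] at hdev
  linarith

end IsCubeCoding

end QB

theorem mainTheorem9 (ℓ D : ℕ) (hℓ : 2 ≤ ℓ)
    (I : List (Fin (ℓ ^ D)) → Set (EuclideanSpace ℝ (Fin D))) (hI : QB.IsCubeCoding ℓ D I)
    (m : Measure (EuclideanSpace ℝ (Fin D))) [IsProbabilityMeasure m]
    (hm : QB.IsQuasiBernoulli I m)
    (d σ : ℝ) (hd : d = -deriv (QB.lqSpectrum ℓ m) 1) (hσ : 0 < σ)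
    (hτ : (fun q : ℝ => QB.lqSpectrum ℓ m (1 - q) - (q * d + σ ^ 2 / 2 * q ^ 2))
      =o[𝓝 0] fun q : ℝ => q ^ 2) :
    (∃ E : Set (EuclideanSpace ℝ (Fin D)),
        MeasurableSet E ∧ m E = 1 ∧ Measure.hausdorffMeasure d E = 0) ∧
      m ⟂ₘ Measure.hausdorffMeasure d ∧
      (∀ E : Set (EuclideanSpace ℝ (Fin D)),
        QB.packingMeasure (EuclideanSpace ℝ (Fin D)) d E < ∞ → m E = 0) ∧
      (∀ E : Set (EuclideanSpace ℝ (Fin D)),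
        QB.packingMeasure (EuclideanSpace ℝ (Fin D)) d E = 0 → m E = 0) := by
  have hH := hI.exists_measurableSet_hausdorffMeasure_eq_zero hℓ hm hσ hτ
  have hP : ∀ E : Set (EuclideanSpace ℝ (Fin D)),
      QB.packingMeasure (EuclideanSpace ℝ (Fin D)) d E < ∞ → m E = 0 := fun E hE =>
    QB.measure_eq_zero_of_packingMeasure_lt_top m
      (fun _ h => QB.measure_eq_zero_of_packingPreMeasure_lt_top m
        (hI.ae_exists_ball_le hℓ hm hσ hτ) h) hE
  refine ⟨hH, ?_, hP, fun E hE => hP E (hE ▸ ENNReal.zero_lt_top)⟩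
  obtain ⟨E, hE, hmE, hHE⟩ := hH
  refine ⟨Eᶜ, hE.compl, (prob_compl_eq_zero_iff hE).2 hmE, ?_⟩
  rw [compl_compl]
  exact hHE
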